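/- **Theorem 1.** Let $M$ be a hyperbolic 3-manifold, that is, $M=\mathbb H^3/\Gamma$ for a discrete group $\Gamma$ of isometries of $\mathbb H^3$ acting freely. A *carrier graph* for $M$ is a continuous map $f\colon X\to M$ from a finite connected graph $X$ (loops and multiple edges allowed) that takes the edges of $X$ to rectifiable paths, such that $f_*\colon\pi_1(X)\to\pi_1(M)$ is surjective and $\operatorname{rank}\pi_1(X)=\operatorname{rank}\pi_1(M)$, where the rank of a group is the least number of generators. Its length $\operatorname{len}_f(X)$ is the sum of the lengths of the paths $f|_e$ over the edges $e$ of $X$. Two carrier graphs $f\colon X\to M$ and $g\colon Y\to M$ are *equivalent* if there is a homotopy equivalence $\eta\colon X\to Y$ such that $f$ and $g\circ\eta$ are freely homotopic. Let $X$ be a finite graph all of whose vertices have valence at least $3$ (a loop counts twice), and let $f\colon X\to M$ and $g\colon X\to M$ be carrier graphs neither of which is constant on a nondegenerate subarc of an edge. Suppose that either each of $f$ and $g$ has minimal length among all carrier graphs equivalent to it, or each of $f$ and $g$ has minimal length among all carrier graphs for $M$. (The graphs of the competing carrier graphs are arbitrary finite connected graphs.) If $f$ and $g$ are freely homotopic,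 then they are *essentially equivalent*: there is a homeomorphism $\eta\colon X\to X$ that fixes every vertex and maps every edge to itself preserving its orientation, such that $f=g\circ\eta$. -/

import Mathlib

open Set Topology unitInterval

noncomputable section

/-! ### Hyperbolic 3-space (hyperboloid model) -/

/-- Hyperbolic 3-space. The point with `space = v` is the point `(√(1 + ‖v‖²), v)` of the upper
sheet `{(t, v) : t² - ‖v‖² = 1, t > 0}` of the hyperboloid in Minkowski space `ℝ × ℝ³`. -/
@[ext] structure HypSpace where
  /-- the space-like coordinates -/
  space : EuclideanSpace ℝ (Fin 3)

namespace HypSpace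

/-- The time coordinate of a point of the hyperboloid. -/
def time (x : HypSpace) : ℝ := √(1 + ‖x.space‖ ^ 2)

/-- Minus the Minkowski product of two points of the hyperboloid. -/
def pairing (x y : HypSpace) : ℝ := x.time * y.time - inner ℝ x.space y.space

theorem time_sq (x : HypSpace) : x.time ^ 2 = 1 + inner ℝ x.space x.space := by
  rw [time, Real.sq_sqrt (by positivity), real_inner_self_eq_norm_sq]

theorem time_pos (x : HypSpace) : 0 < x.time := Real.sqrt_pos.2 (by positivity)

theorem pairing_comm (x y : HypSpace) : pairing x y = pairing y x := by
  rw [pairing, pairing, real_inner_comm, mul_comm]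

theorem pairing_self (x : HypSpace) : pairing x x = 1 := by
  have := time_sq x
  rw [pairing]; linarith [sq x.time]

/-- The spatial part of the boost that moves `y` to the origin, applied to `x`. -/
def boost (y x : HypSpace) : EuclideanSpace ℝ (Fin 3) :=
  x.space + (inner ℝ x.space y.space / (1 + y.time) - x.time) • y.space

theorem inner_boost (y x z : HypSpace) :
    inner ℝ (boost y x) (boost y z) = pairing x y * pairing y z - pairing x z := by
  have hy := time_sq y
  have hp : (1 + y.time) ≠ 0 := by linarith [time_pos y]
  have hyy : inner ℝ y.space y.space = y.time ^ 2 - 1 := by linarith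
  simp only [boost, pairing, inner_add_left, inner_add_right, real_inner_smul_left,
    real_inner_smul_right, hyy]
  rw [real_inner_comm z.space y.space]
  field_simp
  ring

theorem norm_boost_sq (y x : HypSpace) : ‖boost y x‖ ^ 2 = pairing x y ^ 2 - 1 := by
  rw [← real_inner_self_eq_norm_sq, inner_boost, pairing_comm y x, pairing_self]; ring

theorem one_le_pairing (x y : HypSpace) : 1 ≤ pairing x y := by
  have h1 : 1 ≤ pairing x y ^ 2 := by nlinarith [norm_boost_sq y x, sq_nonneg ‖boost y x‖]
  have h2 : 0 < pairing x y := by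
    have hx : ‖x.space‖ < x.time := Real.lt_sqrt_of_sq_lt (by linarith)
    have hy : ‖y.space‖ < y.time := Real.lt_sqrt_of_sq_lt (by linarith)
    have := mul_lt_mul'' hx hy (norm_nonneg _) (norm_nonneg _)
    rw [pairing]
    linarith [real_inner_le_norm x.space y.space]
  nlinarith

theorem eq_of_pairing_eq_one {x y : HypSpace} (h : pairing x y = 1) : x = y := by
  have hx := time_sq x
  have hy := time_sq y
  have hxy := real_inner_mul_inner_self_le x.space y.space
  rw [pairing] at h
  have ht : x.time = y.time := by
    have : (x.time - y.time) ^ 2 ≤ 0 := by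
      have e1 : inner ℝ x.space y.space = x.time * y.time - 1 := by linarith
      rw [e1, show inner ℝ x.space x.space = x.time ^ 2 - 1 by linarith,
        show inner ℝ y.space y.space = y.time ^ 2 - 1 by linarith] at hxy
      nlinarith
    have := pow_eq_zero_iff (two_ne_zero) |>.1 (le_antisymm this (sq_nonneg _))
    linarith
  have key : inner ℝ (x.space - y.space) (x.space - y.space) = 0 := by
    rw [inner_sub_left, inner_sub_right, inner_sub_right, real_inner_comm x.space y.space]
    rw [ht] at h hx
    linarith [sq y.time]
  rw [inner_self_eq_zero, sub_eq_zero] at key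
  exact HypSpace.ext key

/-- The hyperbolic metric: `cosh d(x, y) = - ⟨x, y⟩` for the Minkowski product `⟨ , ⟩`. -/
instance : MetricSpace HypSpace where
  dist x y := Real.arcosh (pairing x y)
  dist_self x := by
    change Real.arcosh (pairing x x) = 0
    rw [pairing_self, Real.arcosh_eq_zero_iff le_rfl]
  dist_comm x y := by
    change Real.arcosh (pairing x y) = Real.arcosh (pairing y x)
    rw [pairing_comm]
  dist_triangle x y z := by
    change Real.arcosh (pairing x z) ≤ Real.arcosh (pairing x y) + Real.arcosh (pairing y z)
    have h1 := one_le_pairing x y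
    have h2 := one_le_pairing y z
    have h3 := one_le_pairing x z
    rw [← Real.arcosh_cosh (add_nonneg (Real.arcosh_nonneg h1) (Real.arcosh_nonneg h2)),
      Real.arcosh_le_arcosh (by linarith) (Real.cosh_pos _), Real.cosh_add,
      Real.cosh_arcosh h1, Real.cosh_arcosh h2, Real.sinh_arcosh h1, Real.sinh_arcosh h2,
      ← norm_boost_sq, pairing_comm y z, ← norm_boost_sq, Real.sqrt_sq (norm_nonneg _),
      Real.sqrt_sq (norm_nonneg _)]
    have h := inner_boost y x z
    have h' := neg_le_of_abs_le (abs_real_inner_le_norm (boost y x) (boost y z))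
    rw [pairing_comm z y]
    linarith
  eq_of_dist_eq_zero {x y} h := by
    change Real.arcosh (pairing x y) = 0 at h
    exact eq_of_pairing_eq_one ((Real.arcosh_eq_zero_iff (one_le_pairing x y)).1 h)

end HypSpace

/-! ### Hyperbolic 3-manifolds -/

/-- A (complete, connected) hyperbolic 3-manifold, seen as a metric space: `M` is isometric to the
quotient of hyperbolic 3-space by a discrete group `Γ` of isometries that acts freely; `p` is the
quotient map. As closed balls of hyperbolic space are compact, `discrete` is proper
discontinuity of the action, and together with `free` it says that `Γ` is a discrete torsion-free
group of isometries. The distance in the quotient is the distance between orbits, which is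
the path metric of the Riemannian metric of constant curvature `-1` on `M`. -/
def IsHyperbolicThreeManifold (M : Type*) [MetricSpace M] : Prop :=
  ∃ (Γ : Subgroup (HypSpace ≃ᵢ HypSpace)) (p : HypSpace → M),
    (∀ (x : HypSpace) (r : ℝ), {γ : HypSpace ≃ᵢ HypSpace | γ ∈ Γ ∧ dist x (γ x) ≤ r}.Finite) ∧
    (∀ γ ∈ Γ, ∀ x : HypSpace, γ x = x → γ = 1) ∧
    Function.Surjective p ∧
    (∀ x y : HypSpace, p x = p y ↔ ∃ γ ∈ Γ, γ x = y) ∧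
    ∀ x y : HypSpace, dist (p x) (p y) = ⨅ γ : Γ, dist x (γ.1 y)

/-! ### Finite graphs and their geometric realizations -/

/-- A finite graph (loops and multiple edges allowed), with an orientation of each edge. -/
structure FiniteGraph where
  /-- the vertices -/
  V : Type
  /-- the edges -/
  E : Type
  [fintypeV : Fintype V]
  [fintypeE : Fintype E]
  [decEqV : DecidableEq V]
  /-- the initial vertex of an edge -/
  src : E → V
  /-- the terminal vertex of an edge -/
  tgt : E → V

namespace FiniteGraph

attribute [instance] fintypeV fintypeE decEqV

instance (X : FiniteGraph) : TopologicalSpace X.V := ⊥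
instance (X : FiniteGraph) : DiscreteTopology X.V := ⟨rfl⟩
instance (X : FiniteGraph) : TopologicalSpace X.E := ⊥
instance (X : FiniteGraph) : DiscreteTopology X.E := ⟨rfl⟩

/-- The valence of a vertex: the number of edge ends at it (a loop counts twice). -/
def valence (X : FiniteGraph) (v : X.V) : ℕ :=
  (Finset.univ.filter fun e => X.src e = v).card + (Finset.univ.filter fun e => X.tgt e = v).card

/-- The identifications that glue the ends of the intervals `{e} × [0, 1]` to the vertices. -/
inductive Glue (X : FiniteGraph) : X.V ⊕ (X.E × I) → X.V ⊕ (X.E × I) → Prop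
  | src (e : X.E) : Glue X (Sum.inr (e, 0)) (Sum.inl (X.src e))
  | tgt (e : X.E) : Glue X (Sum.inr (e, 1)) (Sum.inl (X.tgt e))

/-- The geometric realization of a graph, a 1-dimensional CW complex. -/
def Realization (X : FiniteGraph) : Type := Quot X.Glue

instance (X : FiniteGraph) : TopologicalSpace X.Realization :=
  inferInstanceAs (TopologicalSpace (Quot X.Glue))

/-- A vertex as a point of the realization. -/
def vertex (X : FiniteGraph) (v : X.V) : X.Realization := Quot.mk _ (Sum.inl v)

/-- The point with parameter `t` on the edge `e`. -/
def edgePoint (X : FiniteGraph) (e : X.E) (t : I) : X.Realization := Quot.mk _ (Sum.inr (e, t))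

end FiniteGraph

/-! ### Carrier graphs -/

/-- The rank of a group: the least cardinality of a generating set (`⊤` if there is no finite
one). -/
def groupRank (G : Type*) [Group G] : ℕ∞ :=
  ⨅ S : {S : Set G // Subgroup.closure S = ⊤}, S.1.encard

section

variable {X Y : FiniteGraph} {M : Type*} [MetricSpace M]

/-- The length of the edge `e` under `f`, i.e. the length of the path `f|_e`. -/
def edgeLength (f : C(X.Realization, M)) (e : X.E) : ENNReal :=
  eVariationOn (fun t : I => f (X.edgePoint e t)) univ

/-- The length of a graph mapped to `M`: the sum of the lengths of its edges. -/
def graphLength (f : C(X.Realization, M)) : ENNReal := ∑ e : X.E, edgeLength f e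

/-- `f : X → M` is a carrier graph: `X` is connected, `f` takes edges to rectifiable paths and is
surjective on fundamental groups, and `rank π₁(X) = rank π₁(M)`. -/
structure IsCarrierGraph (f : C(X.Realization, M)) : Prop where
  connected : PathConnectedSpace X.Realization
  rectifiable : ∀ e : X.E, edgeLength f e ≠ ⊤
  surjective : ∀ x : X.Realization, Function.Surjective (FundamentalGroup.map f x)
  rank_eq : ∀ x : X.Realization,
    groupRank (FundamentalGroup X.Realization x) = groupRank (FundamentalGroup M (f x))

/-- Equivalence of carrier graphs `f : X → M` and `g : Y → M`: there is a homotopy equivalence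
`η : X → Y` such that `f` and `g ∘ η` are freely homotopic. -/
def CarrierEquivalent (f : C(X.Realization, M)) (g : C(Y.Realization, M)) : Prop :=
  ∃ η : ContinuousMap.HomotopyEquiv X.Realization Y.Realization,
    ContinuousMap.Homotopic f (g.comp η.toFun)

/-- `f` has minimal length among all carrier graphs for `M` that are equivalent to `f`. -/
def IsMinimalInClass (f : C(X.Realization, M)) : Prop :=
  ∀ (Y : FiniteGraph) (g : C(Y.Realization, M)), IsCarrierGraph g → CarrierEquivalent f g →
    graphLength f ≤ graphLength g

/-- `f` has minimal length among all carrier graphs for `M`. -/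
def IsMinimalGlobally (f : C(X.Realization, M)) : Prop :=
  ∀ (Y : FiniteGraph) (g : C(Y.Realization, M)), IsCarrierGraph g → graphLength f ≤ graphLength g

/-- `f` does not pause: it is constant on no nondegenerate subarc of an edge. -/
def NeverPauses (f : C(X.Realization, M)) : Prop :=
  ∀ (e : X.E) (a b : I), a < b → ∃ t ∈ Icc a b, f (X.edgePoint e t) ≠ f (X.edgePoint e a)

/-- Essential equivalence: `f = g ∘ η`, where `η : X → X` is a homeomorphism that fixes the
vertices and leaves the edges and their orientations invariant, i.e. it acts on each edge as an
increasing homeomorphism of `[0, 1]`. -/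
def EssentiallyEquivalent (f g : C(X.Realization, M)) : Prop :=
  ∃ η : X.Realization ≃ₜ X.Realization,
    (∀ v : X.V, η (X.vertex v) = X.vertex v) ∧
    (∀ e : X.E, ∃ φ : I ≃o I, ∀ t : I, η (X.edgePoint e t) = X.edgePoint e (φ t)) ∧
    ∀ x : X.Realization, f x = g (η x)

end

end

noncomputable section

namespace HypSpace

/-! ### Hyperbolic trigonometry -/

theorem dist_eq (x y : HypSpace) : dist x y = Real.arcosh (pairing x y) := rfl

theorem cosh_dist (x y : HypSpace) : Real.cosh (dist x y) = pairing x y :=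
  Real.cosh_arcosh (one_le_pairing x y)

theorem dist_eq_of_pairing_eq_cosh {x y : HypSpace} {d : ℝ} (h : pairing x y = Real.cosh d) :
    dist x y = |d| := by
  rw [dist_eq, h, ← Real.cosh_abs, Real.arcosh_cosh (abs_nonneg d)]

theorem pairing_map (γ : HypSpace ≃ᵢ HypSpace) (x y : HypSpace) :
    pairing (γ x) (γ y) = pairing x y := by
  rw [← cosh_dist, γ.dist_eq, cosh_dist]

theorem time_eq {x : HypSpace} {T : ℝ} (hT : 0 ≤ T) (h : T ^ 2 = 1 + inner ℝ x.space x.space) :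
    x.time = T := by
  rw [← time_sq] at h
  exact ((sq_eq_sq₀ hT x.time_pos.le).1 h).symm

/-- The norm of a boosted vector is the hyperbolic sine of the distance. -/
theorem norm_boost (y x : HypSpace) : ‖boost y x‖ = Real.sinh (dist y x) := by
  have h := norm_boost_sq y x
  rw [pairing_comm, ← cosh_dist, Real.cosh_sq, add_sub_cancel_right] at h
  exact (sq_eq_sq₀ (norm_nonneg _) (Real.sinh_nonneg_iff.2 dist_nonneg)).1 h

/-! ### The topology of hyperbolic space -/

theorem norm_space_sub_sq (x y : HypSpace) :
    ‖x.space - y.space‖ ^ 2 = 2 * (pairing x y - 1) + (x.time - y.time) ^ 2 := by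
  have hx := time_sq x
  have hy := time_sq y
  rw [← real_inner_self_eq_norm_sq, inner_sub_left, inner_sub_right, inner_sub_right,
    real_inner_comm x.space y.space, pairing]
  linarith [sq_nonneg x.time]

theorem time_eq_cosh_dist (x : HypSpace) : x.time = Real.cosh (dist (⟨0⟩ : HypSpace) x) := by
  rw [cosh_dist, pairing, inner_zero_left]
  simp [time]

theorem continuous_time : Continuous time := by
  have : time = fun x => Real.cosh (dist (⟨0⟩ : HypSpace) x) := funext time_eq_cosh_dist
  rw [this]
  exact Real.continuous_cosh.comp (continuous_const.dist continuous_id)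

theorem isInducing_space : IsInducing space := by
  rw [isInducing_iff_nhds]
  intro x
  apply le_antisymm
  · rw [← Filter.tendsto_iff_comap, tendsto_iff_norm_sub_tendsto_zero]
    have h : Filter.Tendsto (fun y : HypSpace =>
        √(2 * (Real.cosh (dist y x) - 1) + (y.time - x.time) ^ 2)) (𝓝 x) (𝓝 0) := by
      have hc : Continuous (fun y : HypSpace =>
          √(2 * (Real.cosh (dist y x) - 1) + (y.time - x.time) ^ 2)) := by
        have := continuous_time
        have h2 : Continuous fun y : HypSpace => Real.cosh (dist y x) :=
          Real.continuous_cosh.comp (continuous_id.dist continuous_const)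
        fun_prop
      have := hc.tendsto x
      simpa using this
    refine h.congr fun y => ?_
    rw [cosh_dist, ← norm_space_sub_sq, Real.sqrt_sq (norm_nonneg _)]
  · intro s hs
    obtain ⟨r, hr, hs⟩ := Metric.mem_nhds_iff.1 hs
    have hc : Continuous fun v : EuclideanSpace ℝ (Fin 3) => pairing ⟨v⟩ x := by
      unfold pairing time
      fun_prop
    have hx : pairing ⟨x.space⟩ x < Real.cosh r := by
      change pairing x x < _
      rw [pairing_self]
      exact Real.one_lt_cosh.2 hr.ne'
    have hmem := (hc.tendsto x.space).eventually_lt_const hx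
    refine Filter.mem_comap.2 ⟨_, hmem, fun y hy => hs ?_⟩
    change pairing y x < Real.cosh r at hy
    rw [← cosh_dist, Real.cosh_lt_cosh, abs_of_nonneg dist_nonneg, abs_of_pos hr] at hy
    exact hy

theorem continuous_iff_space {T : Type*} [TopologicalSpace T] {F : T → HypSpace} :
    Continuous F ↔ Continuous fun t => (F t).space :=
  isInducing_space.continuous_iff

/-! ### Combinations of two points -/

/-- The squared Minkowski norm of the point `(1 - t) a + t b`. -/
def combNormSq (a b : HypSpace) (t : I) : ℝ := 1 + 2 * (t * (1 - t)) * (pairing a b - 1)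

theorem combNormSq_pos (a b : HypSpace) (t : I) : 0 < combNormSq a b t := by
  have := one_le_pairing a b
  have h1 : 0 ≤ (t : ℝ) * (1 - t) := mul_nonneg t.2.1 (by linarith [t.2.2])
  have := mul_nonneg h1 (sub_nonneg.2 this)
  rw [combNormSq]; linarith

/-- The point of the hyperboloid on the ray through `(1 - t) a + t b`. -/
def comb (a b : HypSpace) (t : I) : HypSpace :=
  ⟨(√(combNormSq a b t))⁻¹ • ((1 - (t : ℝ)) • a.space + (t : ℝ) • b.space)⟩

theorem time_comb (a b : HypSpace) (t : I) :
    (comb a b t).time = (√(combNormSq a b t))⁻¹ * ((1 - t) * a.time + t * b.time) := by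
  have hN := combNormSq_pos a b t
  have hN' := Real.sqrt_pos.2 hN
  apply time_eq
  · have := t.2.1
    have := t.2.2
    have h1 := mul_nonneg (sub_nonneg.2 t.2.2) a.time_pos.le
    have h2 := mul_nonneg t.2.1 b.time_pos.le
    positivity
  · simp only [comb, inner_smul_left, inner_smul_right, inner_add_left, inner_add_right,
      RCLike.conj_to_real]
    rw [real_inner_comm a.space b.space, mul_pow, inv_pow, Real.sq_sqrt hN.le]
    have h : (√(combNormSq a b t))⁻¹ * (√(combNormSq a b t))⁻¹ = (combNormSq a b t)⁻¹ := by
      rw [← mul_inv, Real.mul_self_sqrt hN.le]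
    have ha := time_sq a
    have hb := time_sq b
    have key : ∀ Z : ℝ, (√(combNormSq a b t))⁻¹ * ((√(combNormSq a b t))⁻¹ * Z) =
      (combNormSq a b t)⁻¹ * Z := fun Z => by rw [← mul_assoc, h]
    have key' : ∀ u v : ℝ, (√(combNormSq a b t))⁻¹ * ((1 - (t : ℝ)) * ((√(combNormSq a b t))⁻¹ * u) +
        t * ((√(combNormSq a b t))⁻¹ * v)) = (combNormSq a b t)⁻¹ * ((1 - t) * u + t * v) :=
      fun u v => by rw [← key]; ring
    rw [key']
    have hN0 := hN.ne'
    field_simp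
    rw [combNormSq, pairing]
    linear_combination (1 - (t : ℝ)) ^ 2 * ha + (t : ℝ) ^ 2 * hb

theorem pairing_comb (a b z : HypSpace) (t : I) : pairing (comb a b t) z =
    (√(combNormSq a b t))⁻¹ * ((1 - t) * pairing a z + t * pairing b z) := by
  rw [pairing, time_comb, pairing, pairing]
  simp only [comb, inner_smul_left, inner_add_left, RCLike.conj_to_real]
  ring

@[simp] theorem comb_zero (a b : HypSpace) : comb a b 0 = a := by
  ext1; simp [comb, combNormSq]

@[simp] theorem comb_one (a b : HypSpace) : comb a b 1 = b := by
  ext1; simp [comb, combNormSq]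

/-- A combination of `a` and `b` is determined by its distances to `a` and `b`. -/
theorem eq_comb {a b q : HypSpace} {t : I} (ha : pairing a q = pairing a (comb a b t))
    (hb : pairing b q = pairing b (comb a b t)) : q = comb a b t := by
  refine (eq_of_pairing_eq_one ?_).symm
  rw [pairing_comb, ha, hb, ← pairing_comb, pairing_self]

theorem map_comb (γ : HypSpace ≃ᵢ HypSpace) (a b : HypSpace) (t : I) :
    γ (comb a b t) = comb (γ a) (γ b) t := by
  have h : combNormSq (γ a) (γ b) t = combNormSq a b t := by
    rw [combNormSq, combNormSq, pairing_map]
  apply eq_comb <;>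
    rw [pairing_map, pairing_comm _ (comb _ _ _), pairing_comm _ (comb _ _ _), pairing_comb,
      pairing_comb, h, pairing_map, pairing_map]

theorem continuous_comb {T : Type*} [TopologicalSpace T] {F G : T → HypSpace} {τ : T → I}
    (hF : Continuous F) (hG : Continuous G) (hτ : Continuous τ) :
    Continuous fun x => comb (F x) (G x) (τ x) := by
  rw [continuous_iff_space] at hF hG ⊢
  simp only [comb]
  refine Continuous.smul (Continuous.inv₀ ?_ fun x =>
    (Real.sqrt_pos.2 (combNormSq_pos _ _ _)).ne') (by fun_prop)
  unfold combNormSq pairing time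
  fun_prop

/-! ### Midpoints -/

/-- The midpoint of two points. -/
def mid (a b : HypSpace) : HypSpace := comb a b ⟨1 / 2, by norm_num, by norm_num⟩

theorem mid_comm (a b : HypSpace) : mid a b = mid b a := by
  ext1
  simp only [mid, comb, combNormSq, pairing_comm a b]
  rw [add_comm]
  norm_num [add_comm]

theorem map_mid (γ : HypSpace ≃ᵢ HypSpace) (a b : HypSpace) : γ (mid a b) = mid (γ a) (γ b) :=
  map_comb γ a b _

/-- The Gram determinant of three points (up to sign); it vanishes if and only if the points lie
on a line. -/
def gram (a b c : HypSpace) : ℝ :=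
  2 * pairing a b * pairing b c * pairing a c + 1 - pairing a b ^ 2 - pairing b c ^ 2 -
    pairing a c ^ 2

theorem gram_rotate (a b c : HypSpace) : gram a b c = gram b c a := by
  rw [gram, gram, pairing_comm c a, pairing_comm b a]; ring

theorem gram_swap (a b c : HypSpace) : gram a b c = gram b a c := by
  rw [gram, gram, pairing_comm b a]; ring

theorem gram_map (γ : HypSpace ≃ᵢ HypSpace) (a b c : HypSpace) :
    gram (γ a) (γ b) (γ c) = gram a b c := by
  simp only [gram, pairing_map]

theorem gram_eq (a b c : HypSpace) : gram a b c =
    ‖boost a b‖ ^ 2 * ‖boost a c‖ ^ 2 - inner ℝ (boost a b) (boost a c) ^ 2 := by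
  rw [norm_boost_sq, norm_boost_sq, inner_boost, gram, pairing_comm b a, pairing_comm c a]
  ring

theorem gram_nonneg (a b c : HypSpace) : 0 ≤ gram a b c := by
  rw [gram_eq, sub_nonneg, ← mul_pow]
  exact sq_le_sq' (neg_le_of_abs_le (abs_real_inner_le_norm _ _)) (real_inner_le_norm _ _)

theorem pairing_mid_sq (a b c : HypSpace) : 4 * (1 + pairing a c) * (1 + pairing b c) *
      (Real.cosh (dist a b / 2) ^ 2 - pairing (mid c a) (mid c b) ^ 2) = gram a b c := by
  have hA := one_le_pairing a c
  have hB := one_le_pairing b c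
  have hP : Real.cosh (dist a b / 2) ^ 2 = (1 + pairing a b) / 2 := by
    have := Real.cosh_two_mul (dist a b / 2)
    rw [mul_div_cancel₀ _ two_ne_zero, cosh_dist, Real.sinh_sq] at this
    linarith
  have n1 : combNormSq c a ⟨1 / 2, by norm_num, by norm_num⟩ = (1 + pairing a c) / 2 := by
    rw [combNormSq, pairing_comm c a]; norm_num; ring
  have n2 : combNormSq c b ⟨1 / 2, by norm_num, by norm_num⟩ = (1 + pairing b c) / 2 := by
    rw [combNormSq, pairing_comm c b]; norm_num; ring
  have hm : pairing (mid c a) (mid c b) ^ 2 =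
      (1 + pairing a c + pairing b c + pairing a b) ^ 2 /
        (4 * (1 + pairing a c) * (1 + pairing b c)) := by
    rw [mid, pairing_comb, pairing_comm c, pairing_comm a, mid, pairing_comb, pairing_comb, n1, n2,
      pairing_self, pairing_comm b a]
    simp only [mul_pow, inv_pow]
    rw [show ∀ u v : ℝ, (1 - 1 / 2) * ((√((1 + pairing b c) / 2))⁻¹ * u) +
      1 / 2 * ((√((1 + pairing b c) / 2))⁻¹ * v) = (√((1 + pairing b c) / 2))⁻¹ * ((u + v) / 2) by
        intros; ring]
    · rw [mul_pow, inv_pow, Real.sq_sqrt (by linarith), Real.sq_sqrt (by linarith)]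
      rw [pairing_comm c a]
      field_simp
      ring
  rw [hP, hm, gram]
  field_simp
  ring

theorem dist_mid_le (a b c : HypSpace) : dist (mid c a) (mid c b) ≤ dist a b / 2 := by
  have h := pairing_mid_sq a b c
  have hA := one_le_pairing a c
  have hB := one_le_pairing b c
  have hg := gram_nonneg a b c
  have : 0 ≤ Real.cosh (dist a b / 2) ^ 2 - pairing (mid c a) (mid c b) ^ 2 := by
    rw [← h] at hg
    exact nonneg_of_mul_nonneg_right hg (by positivity)
  rw [sub_nonneg, sq_le_sq₀ (by linarith [one_le_pairing (mid c a) (mid c b)])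
    (Real.cosh_pos _).le, ← cosh_dist, Real.cosh_le_cosh, abs_of_nonneg dist_nonneg,
    abs_of_nonneg (by positivity)] at this
  exact this

theorem gram_eq_zero_of_dist_mid {a b c : HypSpace} (h : dist (mid c a) (mid c b) = dist a b / 2) :
    gram a b c = 0 := by
  rw [← pairing_mid_sq, ← cosh_dist (mid c a), h, sub_self, mul_zero]

/-- The distance function of hyperbolic space is convex. -/
theorem dist_mid_mid_le (a b c d : HypSpace) :
    dist (mid a c) (mid b d) ≤ (dist a b + dist c d) / 2 := by
  have h1 := dist_mid_le a b c
  have h2 := dist_mid_le c d b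
  have := dist_triangle (mid a c) (mid c b) (mid b d)
  rw [mid_comm a c] at *
  rw [mid_comm c b] at this h1
  linarith

/-- Equality in the convexity of the distance function only occurs along a line. -/
theorem gram_eq_zero_of_dist_mid_mid {a b c d : HypSpace}
    (h : dist (mid a c) (mid b d) = (dist a b + dist c d) / 2) :
    gram a c b = 0 ∧ gram b d a = 0 := by
  have h1 := dist_mid_le a b c
  have h2 := dist_mid_le c d b
  have h3 := dist_triangle (mid a c) (mid c b) (mid b d)
  have h1' := dist_mid_le a b d
  have h2' := dist_mid_le c d a
  have h3' := dist_triangle (mid a c) (mid a d) (mid b d)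
  rw [mid_comm a c, mid_comm c b] at *
  rw [mid_comm d a, mid_comm d b] at h1'
  constructor
  · rw [gram_rotate, gram_swap, gram_rotate, gram_rotate]
    apply gram_eq_zero_of_dist_mid
    rw [mid_comm c b]
    rw [mid_comm c a] at *
    linarith
  · rw [← gram_rotate]
    apply gram_eq_zero_of_dist_mid
    rw [mid_comm d a, mid_comm d b]
    rw [mid_comm c a] at *
    linarith

/-! ### Geodesics -/

/-- The boost that moves `y` to the origin. -/
def boostPoint (y x : HypSpace) : HypSpace := ⟨boost y x⟩

/-- The point opposite to `y` with respect to the origin. -/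
def opp (y : HypSpace) : HypSpace := ⟨-y.space⟩

theorem time_opp (y : HypSpace) : (opp y).time = y.time := by simp [time, opp]

theorem time_boostPoint (y x : HypSpace) : (boostPoint y x).time = pairing x y := by
  apply time_eq (by linarith [one_le_pairing x y])
  rw [boostPoint, inner_boost, pairing_comm y x, pairing_self]; ring

theorem pairing_boostPoint (y x z : HypSpace) :
    pairing (boostPoint y x) (boostPoint y z) = pairing x z := by
  rw [pairing, time_boostPoint, time_boostPoint]
  simp only [boostPoint, inner_boost]
  rw [pairing_comm y z]; ring

theorem boostPoint_opp_boostPoint (y x : HypSpace) : boostPoint (opp y) (boostPoint y x) = x := by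
  have hy := time_sq y
  have hp : (1 + y.time) ≠ 0 := by linarith [time_pos y]
  have hyy : inner ℝ y.space y.space = y.time ^ 2 - 1 := by linarith
  ext1
  change (boostPoint y x).space + (inner ℝ (boostPoint y x).space (opp y).space /
    (1 + (opp y).time) - (boostPoint y x).time) • (opp y).space = x.space
  rw [time_boostPoint, time_opp]
  simp only [opp, boostPoint, boost, pairing, inner_add_left, inner_neg_right,
    real_inner_smul_left, hyy, smul_neg]
  rw [add_assoc, ← neg_smul, ← add_smul]
  convert! add_zero _
  convert! zero_smul ℝ _
  field_simp
  ring

/-- The line through `y` with direction `u` (a unit vector, in the frame obtained by boosting `y`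
to the origin). -/
def ray (y : HypSpace) (u : EuclideanSpace ℝ (Fin 3)) (s : ℝ) : HypSpace :=
  boostPoint (opp y) ⟨Real.sinh s • u⟩

theorem dist_ray {u : EuclideanSpace ℝ (Fin 3)} (hu : ‖u‖ = 1) (y : HypSpace) (s t : ℝ) :
    dist (ray y u s) (ray y u t) = |s - t| := by
  apply dist_eq_of_pairing_eq_cosh
  have ht : ∀ r : ℝ, (⟨Real.sinh r • u⟩ : HypSpace).time = Real.cosh r := fun r => by
    apply time_eq (Real.cosh_pos _).le
    rw [inner_smul_left, inner_smul_right, real_inner_self_eq_norm_sq, hu, Real.cosh_sq]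
    simp; ring
  rw [ray, ray, pairing_boostPoint, pairing, ht, ht, inner_smul_left, inner_smul_right,
    real_inner_self_eq_norm_sq, hu, Real.cosh_sub]
  simp

theorem boost_self (a : HypSpace) : boost a a = 0 := by
  rw [← norm_eq_zero, norm_boost, dist_self, Real.sinh_zero]

theorem ray_eq_of_boost {a q : HypSpace} {u : EuclideanSpace ℝ (Fin 3)} {s : ℝ}
    (h : boost a q = Real.sinh s • u) : ray a u s = q := by
  rw [ray, ← h]
  exact boostPoint_opp_boostPoint a q

theorem ray_zero (a : HypSpace) (u : EuclideanSpace ℝ (Fin 3)) : ray a u 0 = a :=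
  ray_eq_of_boost (by simp [boost_self])

/-- The direction of `b` seen from `a`. -/
def dir (a b : HypSpace) : EuclideanSpace ℝ (Fin 3) := ‖boost a b‖⁻¹ • boost a b

theorem boost_ne_zero {a b : HypSpace} (h : a ≠ b) : boost a b ≠ 0 := by
  rw [← norm_ne_zero_iff, norm_boost]
  exact (Real.sinh_pos_iff.2 (dist_pos.2 h)).ne'

theorem norm_dir {a b : HypSpace} (h : a ≠ b) : ‖dir a b‖ = 1 :=
  norm_smul_inv_norm (𝕜 := ℝ) (boost_ne_zero h)

/-- The geodesic with unit speed that starts at `a` towards `b`. -/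
def geod (a b : HypSpace) (s : ℝ) : HypSpace := ray a (dir a b) s

theorem dist_geod {a b : HypSpace} (h : a ≠ b) (s t : ℝ) :
    dist (geod a b s) (geod a b t) = |s - t| :=
  dist_ray (norm_dir h) a s t

@[simp] theorem geod_zero (a b : HypSpace) : geod a b 0 = a := ray_zero _ _

theorem geod_self (a : HypSpace) (s : ℝ) : geod a a s = a :=
  ray_eq_of_boost (by simp [dir, boost_self])

/-- Geodesics between two points are unique. -/
theorem eq_geod {a b q : HypSpace} (h : dist a q + dist q b = dist a b) :
    q = geod a b (dist a q) := by
  rcases eq_or_ne a b with rfl | hab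
  · rw [geod_self]
    rw [dist_self] at h
    have := dist_comm a q
    exact (dist_le_zero.1 (by linarith [dist_nonneg (x := a) (y := q)])).symm
  refine (ray_eq_of_boost ?_).symm
  have hi : inner ℝ (boost a q) (boost a b) = ‖boost a q‖ * ‖boost a b‖ := by
    rw [inner_boost, norm_boost, norm_boost, ← cosh_dist, ← cosh_dist, ← cosh_dist, dist_comm q a,
      eq_sub_of_add_eq' h, Real.cosh_sub]
    ring
  have h1 := inner_eq_norm_mul_iff_real.1 hi
  have h2 : ‖boost a b‖ ≠ 0 := norm_ne_zero_iff.2 (boost_ne_zero hab)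
  rw [← norm_boost, dir, smul_comm, ← h1, smul_smul, inv_mul_cancel₀ h2, one_smul]

@[simp] theorem geod_dist (a b : HypSpace) : geod a b (dist a b) = b :=
  (eq_geod (by rw [dist_self, add_zero])).symm

theorem dist_left_geod {a b : HypSpace} {s : ℝ} (hs : s ∈ Icc 0 (dist a b)) :
    dist a (geod a b s) = s := by
  rcases eq_or_ne a b with rfl | hab
  · rw [dist_self, Icc_self] at hs
    rw [geod_self, dist_self, hs]
  have := dist_geod hab 0 s
  rwa [geod_zero, zero_sub, abs_neg, abs_of_nonneg hs.1] at this

theorem dist_geod_right {a b : HypSpace} {s : ℝ} (hs : s ∈ Icc 0 (dist a b)) :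
    dist (geod a b s) b = dist a b - s := by
  rcases eq_or_ne a b with rfl | hab
  · rw [dist_self, Icc_self] at hs
    rw [geod_self, dist_self, hs, sub_zero]
  have := dist_geod hab s (dist a b)
  rw [geod_dist] at this
  rw [this, abs_sub_comm, abs_of_nonneg (sub_nonneg.2 hs.2)]

theorem dist_geod_le (a b : HypSpace) (s t : ℝ) : dist (geod a b s) (geod a b t) ≤ |s - t| := by
  rcases eq_or_ne a b with rfl | hab
  · rw [geod_self, geod_self, dist_self]; positivity
  · exact (dist_geod hab s t).le

theorem eq_geod_of_dist {a b q : HypSpace} {s : ℝ} (h1 : dist a q = s)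
    (h2 : dist q b = dist a b - s) : q = geod a b s := by
  rw [← h1]
  exact eq_geod (by rw [h1, h2]; ring)

theorem map_geod (γ : HypSpace ≃ᵢ HypSpace) {a b : HypSpace} {s : ℝ}
    (hs : s ∈ Icc 0 (dist a b)) : γ (geod a b s) = geod (γ a) (γ b) s := by
  apply eq_geod_of_dist
  · rw [γ.dist_eq, dist_left_geod hs]
  · rw [γ.dist_eq, γ.dist_eq, dist_geod_right hs]

theorem geod_comm {a b : HypSpace} {s : ℝ} (hs : s ∈ Icc 0 (dist a b)) :
    geod b a s = geod a b (dist a b - s) := by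
  have hs' : s ∈ Icc 0 (dist b a) := by rwa [dist_comm]
  apply eq_geod_of_dist
  · rw [dist_comm, dist_geod_right hs', dist_comm]
  · rw [dist_comm, dist_left_geod hs']; ring

/-- If `z` lies on the line through `x` and `y`, then the geodesic from `x` to `z` follows this
line in one of the two directions. -/
theorem exists_sign_geod_eq {x y z : HypSpace} (hxy : x ≠ y) (hxz : x ≠ z)
    (h : gram x y z = 0) :
    (∀ ε ∈ Icc 0 (dist x z), geod x z ε = geod x y ε) ∨
      ∀ ε ∈ Icc 0 (dist x z), geod x z ε = geod x y (-ε) := by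
  rw [gram_eq, sub_eq_zero, ← mul_pow, sq_eq_sq_iff_abs_eq_abs] at h
  have h' : ‖inner ℝ (boost x y) (boost x z)‖ = ‖boost x y‖ * ‖boost x z‖ := by
    rw [Real.norm_eq_abs, ← h, abs_of_nonneg (by positivity)]
  obtain ⟨r, hr⟩ := (norm_inner_eq_norm_iff (boost_ne_zero hxy) (boost_ne_zero hxz)).1 h' |>.elim
    fun r hr => (⟨r, hr.2⟩ : ∃ r : ℝ, boost x z = r • boost x y)
  obtain ⟨τ, hτ⟩ := Real.sinh_surjective (r * ‖boost x y‖)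
  have hz : geod x y τ = z := by
    refine ray_eq_of_boost ?_
    rw [hr, hτ, dir, smul_smul, mul_assoc, mul_inv_cancel₀
      (norm_ne_zero_iff.2 (boost_ne_zero hxy)), mul_one]
  have key : ∀ t, dist x (geod x y t) = |t| := fun t => by
    have := dist_geod hxy 0 t
    rwa [geod_zero, zero_sub, abs_neg] at this
  have hd : dist x z = |τ| := by rw [← hz, key]
  have key' : ∀ t, dist (geod x y t) z = |t - τ| := fun t => by
    conv_lhs => rw [← hz]
    exact dist_geod hxy t τ
  rcases le_total 0 τ with h0 | h0
  · left
    intro ε hε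
    rw [hd, abs_of_nonneg h0] at hε
    refine (eq_geod_of_dist ?_ ?_).symm
    · rw [key, abs_of_nonneg hε.1]
    · rw [key', hd, abs_of_nonneg h0, abs_sub_comm, abs_of_nonneg (sub_nonneg.2 hε.2)]
  · right
    intro ε hε
    rw [hd, abs_of_nonpos h0] at hε
    refine (eq_geod_of_dist ?_ ?_).symm
    · rw [key, abs_neg, abs_of_nonneg hε.1]
    · rw [key', hd, abs_of_nonpos h0, abs_of_nonneg (by linarith [hε.2])]; ring

end HypSpace
end

noncomputable section

/-! ### The covering of a hyperbolic manifold by hyperbolic space -/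

instance HypSpace.isometryAction : MulAction (HypSpace ≃ᵢ HypSpace) HypSpace where
  smul γ x := γ x
  one_smul _ := rfl
  mul_smul _ _ _ := rfl

/-- `p` is the quotient map of hyperbolic space by the discrete group `Γ` of isometries, which acts
freely. -/
structure IsUniformization {M : Type*} [MetricSpace M] (Γ : Subgroup (HypSpace ≃ᵢ HypSpace))
    (p : HypSpace → M) : Prop where
  finite (x : HypSpace) (r : ℝ) : {γ : HypSpace ≃ᵢ HypSpace | γ ∈ Γ ∧ dist x (γ x) ≤ r}.Finite
  free : ∀ γ ∈ Γ, ∀ x : HypSpace, γ x = x → γ = 1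
  surjective : Function.Surjective p
  eq_iff (x y : HypSpace) : p x = p y ↔ ∃ γ ∈ Γ, γ x = y
  dist_eq (x y : HypSpace) : dist (p x) (p y) = ⨅ γ : Γ, dist x (γ.1 y)

namespace IsUniformization

variable {M : Type*} [MetricSpace M] {Γ : Subgroup (HypSpace ≃ᵢ HypSpace)} {p : HypSpace → M}
  (hp : IsUniformization Γ p)
include hp

theorem map_eq (γ : Γ) (x : HypSpace) : p (γ.1 x) = p x :=
  ((hp.eq_iff x _).2 ⟨γ.1, γ.2, rfl⟩).symm

theorem dist_le (x y : HypSpace) : dist (p x) (p y) ≤ dist x y := by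
  rw [hp.dist_eq]
  exact ciInf_le ⟨0, by rintro _ ⟨γ, rfl⟩; exact dist_nonneg⟩ (1 : Γ)

theorem continuous : Continuous p :=
  LipschitzWith.continuous (K := 1) (LipschitzWith.of_dist_le_mul fun x y => by
    simpa using hp.dist_le x y)

theorem isOpenMap : IsOpenMap p := by
  rw [IsOpenMap]
  intro U hU
  rw [Metric.isOpen_iff]
  rintro _ ⟨x, hx, rfl⟩
  obtain ⟨r, hr, hrU⟩ := Metric.isOpen_iff.1 hU x hx
  refine ⟨r, hr, fun m hm => ?_⟩
  obtain ⟨y, rfl⟩ := hp.surjective m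
  rw [Metric.mem_ball, dist_comm, hp.dist_eq] at hm
  obtain ⟨γ, hγ⟩ := exists_lt_of_ciInf_lt hm
  exact ⟨γ.1 y, hrU (by rwa [Metric.mem_ball, dist_comm]), hp.map_eq γ y⟩

theorem exists_le_dist_map (x : HypSpace) :
    ∃ r > 0, ∀ γ ∈ Γ, γ ≠ 1 → r ≤ dist x (γ x) := by
  have hfin : {γ | (γ ∈ Γ ∧ dist x (γ x) ≤ 1) ∧ γ ≠ 1}.Finite :=
    (hp.finite x 1).subset fun γ h => h.1
  obtain ⟨r, hr, hle⟩ : ∃ r > 0, ∀ γ ∈ {γ | (γ ∈ Γ ∧ dist x (γ x) ≤ 1) ∧ γ ≠ 1},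
      r ≤ dist x (γ x) := by
    rcases Set.eq_empty_or_nonempty {γ | (γ ∈ Γ ∧ dist x (γ x) ≤ 1) ∧ γ ≠ 1} with h | h
    · exact ⟨1, one_pos, by simp [h]⟩
    · obtain ⟨δ, hδ, hmin⟩ := hfin.exists_minimalFor (fun γ => dist x (γ x)) _ h
      refine ⟨dist x (δ x), dist_pos.2 fun h => hδ.2 (hp.free δ hδ.1.1 x h.symm), fun γ hγ => ?_⟩
      by_contra hlt
      exact hlt (hmin hγ (not_le.1 hlt).le)
  refine ⟨min r 1, lt_min hr one_pos, fun γ hγ h1 => ?_⟩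
  by_cases h : dist x (γ x) ≤ 1
  · exact (min_le_left _ _).trans (hle γ ⟨⟨hγ, h⟩, h1⟩)
  · exact (min_le_right _ _).trans (not_le.1 h).le

/-- Around every point, distinct translates of a small ball are far apart. -/
theorem exists_ball (x : HypSpace) : ∃ r > 0, ∀ y ∈ Metric.ball x r, ∀ z ∈ Metric.ball x r,
    ∀ γ ∈ Γ, γ ≠ 1 → dist y z < dist y (γ z) := by
  obtain ⟨r, hr, h⟩ := hp.exists_le_dist_map x
  refine ⟨r / 4, by positivity, fun y hy z hz γ hγ h1 => ?_⟩
  have := h γ hγ h1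
  have h2 := dist_triangle4 x y (γ z) (γ x)
  have h3 := dist_triangle_right y z x
  rw [γ.dist_eq] at h2
  rw [Metric.mem_ball] at hy hz
  rw [dist_comm x y] at h2
  linarith

theorem exists_isometry_ball (x : HypSpace) : ∃ r > 0, ∀ y ∈ Metric.ball x r,
    ∀ z ∈ Metric.ball x r, dist (p y) (p z) = dist y z := by
  obtain ⟨r, hr, h⟩ := hp.exists_ball x
  refine ⟨r, hr, fun y hy z hz => le_antisymm (hp.dist_le y z) ?_⟩
  rw [hp.dist_eq]
  refine le_ciInf fun γ => ?_
  by_cases h1 : γ.1 = 1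
  · rw [h1]; rfl
  · exact (h y hy z hz γ.1 γ.2 h1).le

theorem isCoveringMap : IsCoveringMap p := by
  have hq : IsQuotientCoveringMap p Γ :=
    { (hp.isOpenMap.isQuotientMap hp.continuous hp.surjective) with
      continuous_const_smul := fun γ => γ.1.continuous
      apply_eq_iff_mem_orbit := fun {x y} => by
        rw [eq_comm, hp.eq_iff]
        exact ⟨fun ⟨γ, hγ, h⟩ => ⟨⟨γ, hγ⟩, h⟩, fun ⟨γ, h⟩ => ⟨γ.1, γ.2, h⟩⟩
      disjoint := fun x => by
        obtain ⟨r, hr, h⟩ := hp.exists_ball x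
        refine ⟨_, Metric.ball_mem_nhds x hr, fun γ hγ => ?_⟩
        obtain ⟨_, ⟨z, hz, rfl⟩, hy⟩ := hγ
        by_contra h1
        have := h _ hy z hz γ.1 γ.2 (fun h => h1 (Subtype.ext h))
        change _ < dist (γ.1 z) (γ.1 z) at this
        rw [dist_self] at this
        exact this.not_ge dist_nonneg }
  exact hq.isCoveringMap

/-- The covering projection preserves the length of paths. -/
theorem eVariationOn_comp (c : C(I, HypSpace)) :
    eVariationOn (fun t => p (c t)) univ = eVariationOn c univ := by
  choose r hr h using hp.exists_isometry_ball
  obtain ⟨t, ht0, htm, ⟨n, hn⟩, ht⟩ := exists_monotone_Icc_subset_open_cover_unitInterval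
    (c := fun x => c ⁻¹' Metric.ball x (r x)) (fun x => Metric.isOpen_ball.preimage c.continuous)
    (fun s _ => mem_iUnion.2 ⟨c s, Metric.mem_ball_self (hr _)⟩)
  have hu : (univ : Set I) = Icc (t 0) (t n) := by
    rw [ht0, hn n le_rfl]; ext s; simp [unitInterval.le_one']
  rw [hu, ← eVariationOn.sum' _ htm, ← eVariationOn.sum' _ htm]
  refine Finset.sum_congr rfl fun i _ => ?_
  obtain ⟨x, hx⟩ := ht i
  simp only [eVariationOn]
  congr 1
  ext q
  refine Finset.sum_congr rfl fun j _ => ?_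
  rw [edist_dist, edist_dist, h x _ (hx (q.2.2.2 _)) _ (hx (q.2.2.2 _))]

end IsUniformization
end

noncomputable section

/-! ### Fundamental groups and homotopies -/

open CategoryTheory

section

variable {X : Type*} {Y : Type*} [TopologicalSpace X] [TopologicalSpace Y]

theorem groupRank_le_of_surjective {G : Type*} {H : Type*} [Group G] [Group H] (φ : G →* H)
    (hφ : Function.Surjective φ) : groupRank H ≤ groupRank G := by
  refine le_iInf fun S => ?_
  refine (iInf_le _ (⟨φ '' S.1, ?_⟩ : {S : Set H // Subgroup.closure S = ⊤})).trans
    (Set.encard_image_le φ S.1)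
  rw [← MonoidHom.map_closure, S.2, ← MonoidHom.range_eq_map, MonoidHom.range_eq_top.2 hφ]

theorem groupRank_congr {G : Type*} {H : Type*} [Group G] [Group H] (φ : G ≃* H) :
    groupRank G = groupRank H :=
  le_antisymm (groupRank_le_of_surjective φ.symm.toMonoidHom φ.symm.surjective)
    (groupRank_le_of_surjective φ.toMonoidHom φ.surjective)

theorem ContinuousMap.HomotopyEquiv.bijective_fundamentalGroup_map
    (η : ContinuousMap.HomotopyEquiv X Y) (x : X) :
    Function.Bijective (FundamentalGroup.map η.toFun x) := by
  have e : (FundamentalGroupoid.map η.toFun).IsEquivalence := by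
    refine (CategoryTheory.Equivalence.mk (FundamentalGroupoid.map η.toFun)
      (FundamentalGroupoid.map η.invFun) ?_ ?_).isEquivalence_functor
    · simpa only [FundamentalGroupoid.map_id, FundamentalGroupoid.map_comp] using
        (asIso (FundamentalGroupoidFunctor.homotopicMapsNatIso η.left_inv.some)).symm
    · simpa only [FundamentalGroupoid.map_id, FundamentalGroupoid.map_comp] using
        asIso (FundamentalGroupoidFunctor.homotopicMapsNatIso η.right_inv.some)
  exact ⟨(FundamentalGroupoid.map η.toFun).map_injective,
    (FundamentalGroupoid.map η.toFun).map_surjective⟩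

theorem ContinuousMap.Homotopic.surjective_fundamentalGroup_map {f g : C(X, Y)}
    (h : f.Homotopic g) (x : X) (hf : Function.Surjective (FundamentalGroup.map f x)) :
    Function.Surjective (FundamentalGroup.map g x) := by
  intro q
  set α := FundamentalGroupoidFunctor.homotopicMapsNatIso h.some
  let x' : FundamentalGroupoid X := ⟨x⟩
  let q' : (FundamentalGroupoid.map g).obj x' ⟶ (FundamentalGroupoid.map g).obj x' := q
  let q'' : (FundamentalGroupoid.map f).obj x' ⟶ (FundamentalGroupoid.map f).obj x' :=
    α.app x' ≫ q' ≫ Groupoid.inv (α.app x')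
  obtain ⟨r, hr⟩ := hf q''
  have h1 : (FundamentalGroupoid.map f).map (X := x') (Y := x') r = q'' := hr
  refine ⟨r, ?_⟩
  have h2 := α.naturality (X := x') (Y := x') r
  rw [h1, Category.assoc, Category.assoc, Groupoid.inv_comp, Category.comp_id] at h2
  have h3 := congrArg (Groupoid.inv (α.app x') ≫ ·) h2
  simp only [← Category.assoc, Groupoid.inv_comp, Category.id_comp] at h3
  exact h3.symm

theorem ContinuousMap.HomotopyEquiv.pathConnectedSpace
    (η : ContinuousMap.HomotopyEquiv X Y) [PathConnectedSpace X] : PathConnectedSpace Y := by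
  have hj : ∀ y, Joined y (η.toFun (η.invFun y)) := fun y =>
    ⟨(η.right_inv.some.evalAt y).symm⟩
  refine ⟨(PathConnectedSpace.nonempty (X := X)).map η.toFun, fun y z => (hj y).trans
    (Joined.trans ?_ (hj z).symm)⟩
  exact ⟨(PathConnectedSpace.somePath (η.invFun y) (η.invFun z)).map η.toFun.continuous⟩

end

section

variable {X Y : FiniteGraph} {M : Type*} [MetricSpace M]

/-- Equivalence with a carrier graph preserves the conditions on the fundamental group. -/
theorem IsCarrierGraph.of_homotopyEquiv {f : C(X.Realization, M)} {g : C(Y.Realization, M)}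
    (hf : IsCarrierGraph f) (η : ContinuousMap.HomotopyEquiv X.Realization Y.Realization)
    (h : f.Homotopic (g.comp η.toFun)) (hg : ∀ e, edgeLength g e ≠ ⊤) : IsCarrierGraph g := by
  have := hf.connected
  have h' : (f.comp η.invFun).Homotopic g := by
    refine (h.comp (ContinuousMap.Homotopic.refl η.invFun)).trans ?_
    rw [ContinuousMap.comp_assoc]
    exact (ContinuousMap.Homotopic.refl g).comp η.right_inv
  refine ⟨η.pathConnectedSpace, hg, fun y => ?_, fun y => ?_⟩
  · refine h'.surjective_fundamentalGroup_map y ?_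
    have h1 : ⇑(FundamentalGroup.map (f.comp η.invFun) y) =
        FundamentalGroup.map f (η.invFun y) ∘ FundamentalGroup.map η.invFun y := by
      ext q
      obtain ⟨q, rfl⟩ := Path.Homotopic.Quotient.mk_surjective q
      rfl
    rw [h1]
    exact (hf.surjective _).comp (η.symm.bijective_fundamentalGroup_map y).2
  · rw [groupRank_congr (MulEquiv.ofBijective _ (η.symm.bijective_fundamentalGroup_map y))]
    refine (hf.rank_eq _).trans ?_
    exact groupRank_congr
      (FundamentalGroup.fundamentalGroupMulEquivOfPath (h'.some.evalAt y))

end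
end

noncomputable section

/-! ### Maps on realizations of graphs -/

namespace FiniteGraph

variable {X : FiniteGraph} {Z : Type*} [TopologicalSpace Z]

theorem edgePoint_zero (e : X.E) : X.edgePoint e 0 = X.vertex (X.src e) := Quot.sound (.src e)

theorem edgePoint_one (e : X.E) : X.edgePoint e 1 = X.vertex (X.tgt e) := Quot.sound (.tgt e)

theorem continuous_edgePoint (e : X.E) : Continuous (X.edgePoint e) :=
  continuous_quot_mk.comp (continuous_inr.comp (by fun_prop))

theorem realization_ind {P : X.Realization → Prop} (hv : ∀ v, P (X.vertex v))
    (he : ∀ e t, P (X.edgePoint e t)) (x : X.Realization) : P x := by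
  obtain ⟨y, rfl⟩ := Quot.exists_rep x
  rcases y with v | ⟨e, t⟩
  exacts [hv v, he e t]

/-- The map on the realization of a graph given by points for the vertices and paths for the
edges. -/
def lift (a : X.V → Z) (b : X.E → C(I, Z)) (h0 : ∀ e, b e 0 = a (X.src e))
    (h1 : ∀ e, b e 1 = a (X.tgt e)) : C(X.Realization, Z) where
  toFun := Quot.lift (Sum.elim a fun q => b q.1 q.2) (by
    rintro _ _ (e | e)
    exacts [h0 e, h1 e])
  continuous_toFun := by
    refine continuous_quot_lift _ (continuous_sum_dom.2 ⟨continuous_of_discreteTopology, ?_⟩)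
    exact continuous_prod_of_discrete_left.2 fun e => (b e).continuous

@[simp] theorem lift_vertex {a : X.V → Z} {b : X.E → C(I, Z)} {h0 h1} (v : X.V) :
    lift a b h0 h1 (X.vertex v) = a v := rfl

@[simp] theorem lift_edgePoint {a : X.V → Z} {b : X.E → C(I, Z)} {h0 h1} (e : X.E) (t : I) :
    lift a b h0 h1 (X.edgePoint e t) = b e t := rfl

/-- A homotopy between maps on a graph is given by paths for the vertices and squares for the
edges. -/
theorem homotopic_of_squares {a b : C(X.Realization, Z)} (κ : X.V → C(I, Z))
    (Q : X.E → C(I × I, Z)) (hsrc : ∀ e t, Q e (0, t) = κ (X.src e) t)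
    (htgt : ∀ e t, Q e (1, t) = κ (X.tgt e) t) (hκ0 : ∀ v, κ v 0 = a (X.vertex v))
    (hκ1 : ∀ v, κ v 1 = b (X.vertex v)) (hQ0 : ∀ e s, Q e (s, 0) = a (X.edgePoint e s))
    (hQ1 : ∀ e s, Q e (s, 1) = b (X.edgePoint e s)) : a.Homotopic b := by
  let K : C(X.Realization, C(I, Z)) := lift κ (fun e => (Q e).curry)
    (fun e => by ext t; exact hsrc e t) (fun e => by ext t; exact htgt e t)
  exact ⟨{
    toFun := fun q => K q.2 q.1
    continuous_toFun := by fun_prop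
    map_zero_left := realization_ind hκ0 hQ0
    map_one_left := realization_ind hκ1 hQ1 }⟩

/-! ### Splitting a vertex -/

open Classical in
/-- The graph obtained from `X` by adding a new vertex and a new edge from `v` to the new vertex,
and moving the initial ends of the edges in `A` and the terminal ends of the edges in `B` to the
new vertex. -/
def split (X : FiniteGraph) (v : X.V) (A B : Set X.E) : FiniteGraph where
  V := Option X.V
  E := Option X.E
  src o := o.elim (some v) fun e => if e ∈ A then none else some (X.src e)
  tgt o := o.elim none fun e => if e ∈ B then none else some (X.tgt e)

section split

variable {v : X.V} {A B : Set X.E}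

/-- The map that collapses the new edge. -/
def collapse (hA : ∀ e ∈ A, X.src e = v) (hB : ∀ e ∈ B, X.tgt e = v) :
    C((X.split v A B).Realization, X.Realization) :=
  lift (X := X.split v A B) (fun o : Option X.V => X.vertex (o.getD v))
    (fun o : Option X.E => o.elim (.const I (X.vertex v)) fun e => ⟨_, continuous_edgePoint e⟩)
    (by
      rintro (_ | e)
      · rfl
      · by_cases h : e ∈ A
        · simp [split, h, edgePoint_zero, hA e h]
        · simp [split, h, edgePoint_zero])
    (by
      rintro (_ | e)
      · rfl
      · by_cases h : e ∈ B
        · simp [split, h, edgePoint_one, hB e h]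
        · simp [split, h, edgePoint_one])

variable (v A B) in
/-- The new edge. -/
def newEdge (r : ℝ) : (X.split v A B).Realization :=
  (X.split v A B).edgePoint (none : Option X.E) (projIcc 0 1 zero_le_one r)

theorem continuous_newEdge : Continuous (newEdge v A B) :=
  (continuous_edgePoint _).comp continuous_projIcc

theorem newEdge_zero : newEdge v A B 0 = (X.split v A B).vertex (some v : Option X.V) := by
  rw [newEdge, projIcc_left]; exact edgePoint_zero (X := X.split v A B) none

theorem newEdge_one : newEdge v A B 1 = (X.split v A B).vertex (none : Option X.V) := by
  rw [newEdge, projIcc_right]; exact edgePoint_one (X := X.split v A B) none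

variable (v A B) in
/-- An old edge in the split graph. -/
def oldEdge (e : X.E) (r : ℝ) : (X.split v A B).Realization :=
  (X.split v A B).edgePoint (some e : Option X.E) (projIcc 0 1 zero_le_one r)

theorem continuous_oldEdge (e : X.E) : Continuous (oldEdge v A B e) :=
  (continuous_edgePoint _).comp continuous_projIcc

open Classical in
theorem oldEdge_zero (e : X.E) : oldEdge v A B e 0 =
    (X.split v A B).vertex (if e ∈ A then none else some (X.src e) : Option X.V) := by
  rw [oldEdge, projIcc_left]; exact edgePoint_zero (X := X.split v A B) (some e)

open Classical in
theorem oldEdge_one (e : X.E) : oldEdge v A B e 1 =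
    (X.split v A B).vertex (if e ∈ B then none else some (X.tgt e) : Option X.V) := by
  rw [oldEdge, projIcc_right]; exact edgePoint_one (X := X.split v A B) (some e)

open Classical in
variable (v A B) in
/-- The path in the split graph that follows an old edge on `[0, 1]`, preceded and followed by the
new edge if the respective end has been moved. -/
def track (e : X.E) (r : ℝ) : (X.split v A B).Realization :=
  if r ≤ 0 then (if e ∈ A then newEdge v A B (1 + r) else oldEdge v A B e 0)
  else if r ≤ 1 then oldEdge v A B e r
  else (if e ∈ B then newEdge v A B (2 - r) else oldEdge v A B e 1)

theorem continuous_track (e : X.E) : Continuous (track v A B e) := by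
  have h1 := continuous_newEdge (v := v) (A := A) (B := B)
  have h2 := continuous_oldEdge (v := v) (A := A) (B := B) e
  unfold track
  refine Continuous.if_le ?_ (Continuous.if_le h2 ?_ continuous_id continuous_const ?_)
    continuous_id continuous_const ?_
  · split_ifs <;> fun_prop
  · split_ifs <;> fun_prop
  · rintro r rfl
    split_ifs with h
    · rw [oldEdge_one, if_pos h]; norm_num [newEdge_one]
    · rfl
  · rintro r rfl
    rw [if_pos zero_le_one]
    split_ifs with h
    · rw [oldEdge_zero, if_pos h]; norm_num [newEdge_one]
    · rfl

theorem track_of_mem (e : X.E) {r : ℝ} (hr : r ∈ Icc (0 : ℝ) 1) :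
    track v A B e r = oldEdge v A B e r := by
  rw [track]
  split_ifs with h1 h2 h3 h4 <;> try rfl
  · obtain rfl := le_antisymm h1 hr.1
    rw [oldEdge_zero, if_pos h2]; norm_num [newEdge_one]
  · obtain rfl := le_antisymm h1 hr.1
    rfl
  all_goals exact absurd hr.2 h3

open Classical in
theorem track_of_nonpos (e : X.E) {r : ℝ} (hr : r ≤ 0) :
    track v A B e r = if e ∈ A then newEdge v A B (1 + r) else
      (X.split v A B).vertex (some (X.src e) : Option X.V) := by
  rw [track, if_pos hr]
  split_ifs with h
  · rfl
  · rw [oldEdge_zero, if_neg h]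

open Classical in
theorem track_of_one_le (e : X.E) {r : ℝ} (hr : 1 ≤ r) :
    track v A B e r = if e ∈ B then newEdge v A B (2 - r) else
      (X.split v A B).vertex (some (X.tgt e) : Option X.V) := by
  rw [track, if_neg (by linarith)]
  rcases hr.eq_or_lt with rfl | hr
  · rw [if_pos le_rfl, oldEdge_one]
    split_ifs with h
    · norm_num [newEdge_one]
    · rfl
  rw [if_neg hr.not_ge]
  split_ifs with h
  · rfl
  · rw [oldEdge_one, if_neg h]

theorem collapse_newEdge (hA : ∀ e ∈ A, X.src e = v) (hB : ∀ e ∈ B, X.tgt e = v) (r : ℝ) :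
    collapse hA hB (newEdge v A B r) = X.vertex v := rfl

theorem collapse_oldEdge (hA : ∀ e ∈ A, X.src e = v) (hB : ∀ e ∈ B, X.tgt e = v) (e : X.E)
    (r : ℝ) : collapse hA hB (oldEdge v A B e r) = X.edgePoint e (projIcc 0 1 zero_le_one r) := rfl

theorem collapse_track (hA : ∀ e ∈ A, X.src e = v) (hB : ∀ e ∈ B, X.tgt e = v) (e : X.E)
    (r : ℝ) : collapse hA hB (track v A B e r) = X.edgePoint e (projIcc 0 1 zero_le_one r) := by
  rcases le_total r 0 with h0 | h0
  · rw [track, if_pos h0, projIcc_of_le_left _ h0]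
    split_ifs with h
    · rw [collapse_newEdge, ← hA e h]; exact (edgePoint_zero e).symm
    · rw [collapse_oldEdge, projIcc_left]
  rcases le_total r 1 with h1 | h1
  · rw [track_of_mem e ⟨h0, h1⟩, collapse_oldEdge]
  · rw [track_of_one_le e h1, projIcc_of_right_le _ h1]
    split_ifs with h
    · rw [collapse_newEdge, ← hB e h]; exact (edgePoint_one e).symm
    · exact (edgePoint_one e).symm

variable (v A B) in
/-- The homotopy inverse of the collapsing map. -/
def expand (hA : ∀ e ∈ A, X.src e = v) (hB : ∀ e ∈ B, X.tgt e = v) :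
    C(X.Realization, (X.split v A B).Realization) :=
  lift (fun u => (X.split v A B).vertex (some u : Option X.V))
    (fun e => ⟨fun s => track v A B e (3 * s - 1), (continuous_track e).comp (by fun_prop)⟩)
    (fun e => by
      simp only [ContinuousMap.coe_mk, Icc.coe_zero, mul_zero, zero_sub]
      rw [track_of_nonpos e (by norm_num)]
      split_ifs with h
      · rw [hA e h, ← newEdge_zero]; norm_num
      · rfl)
    (fun e => by
      simp only [ContinuousMap.coe_mk, Icc.coe_one]
      rw [track_of_one_le e (by norm_num)]
      split_ifs with h
      · rw [hB e h, ← newEdge_zero]; norm_num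
      · rfl)

theorem collapse_expand (hA : ∀ e ∈ A, X.src e = v) (hB : ∀ e ∈ B, X.tgt e = v) :
    ((collapse hA hB).comp (expand v A B hA hB)).Homotopic (.id _) := by
  refine homotopic_of_squares (fun u => .const I (X.vertex u))
    (fun e => ⟨fun q => X.edgePoint e (projIcc 0 1 zero_le_one
      ((1 - q.2) * (3 * q.1 - 1) + q.2 * q.1)), (continuous_edgePoint e).comp
        (continuous_projIcc.comp (by fun_prop))⟩) ?_ ?_ (fun v => rfl) (fun v => rfl) ?_ ?_
  · intro e t
    simp only [ContinuousMap.coe_mk, Icc.coe_zero]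
    rw [projIcc_of_le_left _ (by linarith [t.2.2])]
    exact edgePoint_zero e
  · intro e t
    simp only [ContinuousMap.coe_mk, Icc.coe_one]
    rw [projIcc_of_right_le _ (by linarith [t.2.2])]
    exact edgePoint_one e
  · intro e s
    rw [ContinuousMap.comp_apply, expand, lift_edgePoint]
    simp [collapse_track]
  · intro e s
    simp

variable (v A B) in
/-- The path of a vertex of the split graph in the homotopy that undoes the splitting. -/
def slide (o : Option X.V) : C(I, (X.split v A B).Realization) :=
  o.elim ⟨fun t : I => newEdge v A B t, continuous_newEdge.comp continuous_subtype_val⟩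
    fun u => .const I ((X.split v A B).vertex (some u : Option X.V))

open Classical in
theorem slide_ite (p : Prop) (u : X.V) (t : I) :
    slide v A B (if p then none else some u) t =
      if p then newEdge v A B t else (X.split v A B).vertex (some u : Option X.V) := by
  split_ifs <;> rfl

theorem expand_collapse (hA : ∀ e ∈ A, X.src e = v) (hB : ∀ e ∈ B, X.tgt e = v) :
    ((expand v A B hA hB).comp (collapse hA hB)).Homotopic (.id _) := by
  refine homotopic_of_squares (X := X.split v A B) (slide v A B)
    (fun o : Option X.E => o.elim ⟨fun q : I × I => newEdge v A B (q.1 * q.2),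
      continuous_newEdge.comp (by fun_prop)⟩ fun e =>
        ⟨fun q : I × I => track v A B e ((1 - q.2) * (3 * q.1 - 1) + q.2 * q.1),
          (continuous_track e).comp (by fun_prop)⟩) ?_ ?_ ?_ ?_ ?_ ?_
  · rintro (_ | e) t
    · simp only [Option.elim_none, ContinuousMap.coe_mk, Icc.coe_zero, zero_mul, newEdge_zero]
      rfl
    · simp only [Option.elim_some, ContinuousMap.coe_mk, Icc.coe_zero]
      rw [track_of_nonpos e (by linarith [t.2.2])]
      refine Eq.trans ?_ (slide_ite (e ∈ A) (X.src e) t).symm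
      congr 2; ring
  · rintro (_ | e) t
    · simp only [Option.elim_none, ContinuousMap.coe_mk, Icc.coe_one, one_mul]
      rfl
    · simp only [Option.elim_some, ContinuousMap.coe_mk, Icc.coe_one]
      rw [track_of_one_le e (by linarith [t.2.2])]
      refine Eq.trans ?_ (slide_ite (e ∈ B) (X.tgt e) t).symm
      congr 2; ring
  · rintro (_ | u)
    · exact newEdge_zero
    · rfl
  · rintro (_ | u)
    · exact newEdge_one
    · rfl
  · rintro (_ | e) s
    · simp only [Option.elim_none, ContinuousMap.coe_mk, Icc.coe_zero, mul_zero, newEdge_zero]; rfl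
    · simp only [Option.elim_some, ContinuousMap.coe_mk, Icc.coe_zero, sub_zero, one_mul, zero_mul,
        add_zero]
      rfl
  · rintro (_ | e) s
    · simp [newEdge]
    · simp only [Option.elim_some, ContinuousMap.coe_mk, Icc.coe_one, sub_self, one_mul, zero_mul,
        zero_add]
      rw [track_of_mem e s.2]
      simp [oldEdge]

variable (v A B) in
/-- Splitting a vertex does not change the homotopy type. -/
def splitEquiv (hA : ∀ e ∈ A, X.src e = v) (hB : ∀ e ∈ B, X.tgt e = v) :
    ContinuousMap.HomotopyEquiv X.Realization (X.split v A B).Realization where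
  toFun := expand v A B hA hB
  invFun := collapse hA hB
  left_inv := collapse_expand hA hB
  right_inv := expand_collapse hA hB

end split

end FiniteGraph
end

noncomputable section

/-! ### Lifting graphs to hyperbolic space -/

open HypSpace

/-- The path that follows the geodesic from `a` to `b` with constant speed. -/
def HypSpace.geodPath (a b : HypSpace) : C(I, HypSpace) where
  toFun t := geod a b (t * dist a b)
  continuous_toFun := by
    refine (LipschitzWith.of_dist_le_mul (K := 1) (f := geod a b) fun s t => ?_).continuous.comp
      (by fun_prop)
    simpa [Real.dist_eq] using dist_geod_le a b s t

@[simp] theorem HypSpace.geodPath_zero (a b : HypSpace) : geodPath a b 0 = a := by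
  simp [geodPath]

@[simp] theorem HypSpace.geodPath_one (a b : HypSpace) : geodPath a b 1 = b := by
  simp [geodPath]

theorem HypSpace.eVariationOn_geodPath_le (a b : HypSpace) :
    eVariationOn (geodPath a b) univ ≤ edist a b := by
  have h1 : LipschitzOnWith (nndist a b) (fun t : ℝ => geod a b (t * dist a b)) univ := by
    refine (LipschitzWith.of_dist_le_mul fun s t => ?_).lipschitzOnWith
    refine (dist_geod_le a b _ _).trans ?_
    rw [← sub_mul, abs_mul, abs_of_nonneg dist_nonneg, mul_comm, coe_nndist, Real.dist_eq]
  have h2 := h1.comp_eVariationOn_le (g := ((↑) : I → ℝ)) (s := univ) (mapsTo_univ _ _)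
  have h3 : eVariationOn ((↑) : I → ℝ) univ ≤ 1 := by
    have h := MonotoneOn.eVariationOn_eq (f := ((↑) : I → ℝ)) (s := univ)
      (Subtype.mono_coe _ |>.monotoneOn _) (mem_univ 0) (mem_univ 1) |>.le
    have hu : (univ : Set I) ∩ Icc 0 1 = univ := by ext t; simp [unitInterval.le_one']
    rw [hu] at h
    simpa using h
  calc _ ≤ (nndist a b : ENNReal) * eVariationOn ((↑) : I → ℝ) univ := h2
    _ ≤ (nndist a b : ENNReal) * 1 := by gcongr
    _ = edist a b := by rw [mul_one, edist_nndist]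

variable {M : Type*} [MetricSpace M] {X Y : FiniteGraph}

/-- A lift of the map `f` of a graph to hyperbolic space: lifts `x v` of the vertices and lifts
`F e` of the edges, such that `F e` starts at the lift of the initial vertex and ends at the image
under `γ e` of the lift of the terminal vertex. -/
structure IsLift (Γ : Subgroup (HypSpace ≃ᵢ HypSpace)) (p : HypSpace → M)
    (f : C(X.Realization, M)) (γ : X.E → Γ) (x : X.V → HypSpace) (F : X.E → C(I, HypSpace)) :
    Prop where
  vertex (v : X.V) : p (x v) = f (X.vertex v)
  edge (e : X.E) (t : I) : p (F e t) = f (X.edgePoint e t)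
  src (e : X.E) : F e 0 = x (X.src e)
  tgt (e : X.E) : F e 1 = (γ e).1 (x (X.tgt e))

/-- The length of the graph with geodesic edges with given vertices and edge labels. -/
def markedLength {Γ : Subgroup (HypSpace ≃ᵢ HypSpace)} (γ : X.E → Γ) (x : X.V → HypSpace) : ℝ :=
  ∑ e, dist (x (X.src e)) ((γ e).1 (x (X.tgt e)))

variable {Γ : Subgroup (HypSpace ≃ᵢ HypSpace)} {p : HypSpace → M} (hp : IsUniformization Γ p)

theorem ofReal_markedLength (γ : X.E → Γ) (x : X.V → HypSpace) :
    ENNReal.ofReal (markedLength γ x) =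
      ∑ e, edist (x (X.src e)) ((γ e).1 (x (X.tgt e))) := by
  rw [markedLength, ENNReal.ofReal_sum_of_nonneg fun _ _ => dist_nonneg]
  simp only [edist_dist]

namespace IsUniformization
include hp

theorem exists_isLift (f : C(X.Realization, M)) : ∃ γ x F, IsLift Γ p f γ x F := by
  choose x hx using fun v => hp.surjective (f (X.vertex v))
  have hl : ∀ e, ∃ F : C(I, HypSpace), (∀ t, p (F t) = f (X.edgePoint e t)) ∧
      F 0 = x (X.src e) := fun e => by
    obtain ⟨F, h1, h2⟩ := hp.isCoveringMap.exists_path_lifts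
      ⟨fun t => f (X.edgePoint e t), f.continuous.comp (FiniteGraph.continuous_edgePoint e)⟩
      (x (X.src e)) (by rw [hx, ContinuousMap.coe_mk, FiniteGraph.edgePoint_zero])
    exact ⟨F, congrFun h1, h2⟩
  choose F hF hF0 using hl
  have hγ : ∀ e, ∃ γ : Γ, F e 1 = γ.1 (x (X.tgt e)) := fun e => by
    have : p (x (X.tgt e)) = p (F e 1) := by rw [hx, hF, FiniteGraph.edgePoint_one]
    obtain ⟨γ, hγ, h⟩ := (hp.eq_iff _ _).1 this
    exact ⟨⟨γ, hγ⟩, h.symm⟩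
  choose γ hγ using hγ
  exact ⟨γ, x, F, hx, hF, hF0, hγ⟩

/-- Homotopic maps have lifts with the same edge labels. -/
theorem exists_isLift_of_homotopic {f g : C(X.Realization, M)} (h : f.Homotopic g)
    {γ : X.E → Γ} {x : X.V → HypSpace} {F : X.E → C(I, HypSpace)} (hf : IsLift Γ p f γ x F) :
    ∃ y G, IsLift Γ p g γ y G := by
  obtain ⟨K⟩ := h
  have cov := hp.isCoveringMap
  have hP : ∀ v, ∃ P : C(I, HypSpace), p ∘ P = (fun t => K (t, X.vertex v)) ∧ P 0 = x v :=
    fun v => cov.exists_path_lifts ⟨fun t => K (t, X.vertex v), by fun_prop⟩ (x v)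
      (by simp [hf.vertex])
  choose P hP hP0 using hP
  have hL : ∀ e, ∃ L : C(I × I, HypSpace), (∀ t s, p (L (t, s)) = K (t, X.edgePoint e s)) ∧
      ∀ s, L (0, s) = F e s := fun e => by
    have hc := FiniteGraph.continuous_edgePoint (X := X) e
    let H : C(I × I, M) := ⟨fun q => K (q.1, X.edgePoint e q.2), by fun_prop⟩
    have H0 : ∀ s, H (0, s) = p (F e s) := fun s => by simp [H, hf.edge]
    exact ⟨cov.liftHomotopy H (F e) H0,
      fun t s => congrFun (cov.liftHomotopy_lifts H (F e) H0) (t, s),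
      cov.liftHomotopy_zero H (F e) H0⟩
  choose L hL hL0 using hL
  have uniq : ∀ A B : C(I, HypSpace), (∀ t, p (A t) = p (B t)) → A 0 = B 0 → A 1 = B 1 := by
    intro A B h h0
    have := cov.eq_of_comp_eq A.continuous B.continuous (funext h) 0 h0
    exact congrFun this 1
  refine ⟨fun v => P v 1, fun e => ⟨fun s => L e (1, s), by fun_prop⟩, fun v => ?_, fun e t => ?_,
    fun e => ?_, fun e => ?_⟩
  · have := congrFun (hP v) 1
    simpa using this
  · simp [hL]
  · refine uniq ⟨fun t => L e (t, 0), by fun_prop⟩ (P (X.src e)) (fun t => ?_) ?_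
    · simp only [ContinuousMap.coe_mk, hL, FiniteGraph.edgePoint_zero]
      exact (congrFun (hP (X.src e)) t).symm
    · simp [hL0, hP0, hf.src]
  · refine uniq ⟨fun t => L e (t, 1), by fun_prop⟩
      ⟨fun t => (γ e).1 (P (X.tgt e) t), (γ e).1.continuous.comp (P _).continuous⟩ (fun t => ?_) ?_
    · simp only [ContinuousMap.coe_mk, hL, FiniteGraph.edgePoint_one, hp.map_eq]
      exact (congrFun (hP (X.tgt e)) t).symm
    · simp [hL0, hP0, hf.tgt]

/-- Maps that have lifts with the same edge labels are homotopic. -/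
theorem homotopic_of_isLift {f g : C(X.Realization, M)} {γ : X.E → Γ} {x y : X.V → HypSpace}
    {F G : X.E → C(I, HypSpace)} (hf : IsLift Γ p f γ x F) (hg : IsLift Γ p g γ y G) :
    f.Homotopic g := by
  have hc := hp.continuous
  refine FiniteGraph.homotopic_of_squares
    (fun v => ⟨fun t => p (comb (x v) (y v) t),
      hc.comp (continuous_comb continuous_const continuous_const continuous_id)⟩)
    (fun e => ⟨fun q => p (comb (F e q.1) (G e q.1) q.2),
      hc.comp (continuous_comb (by fun_prop) (by fun_prop) continuous_snd)⟩) ?_ ?_ ?_ ?_ ?_ ?_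
  · intro e t
    simp [hf.src, hg.src]
  · intro e t
    simp [hf.tgt, hg.tgt, ← map_comb, hp.map_eq]
  · intro v; simp [hf.vertex]
  · intro v; simp [hg.vertex]
  · intro v; simp [hf.edge]
  · intro v; simp [hg.edge]

theorem edgeLength_eq {f : C(X.Realization, M)} {γ : X.E → Γ} {x : X.V → HypSpace}
    {F : X.E → C(I, HypSpace)} (hf : IsLift Γ p f γ x F) (e : X.E) :
    edgeLength f e = eVariationOn (F e) univ := by
  rw [edgeLength, ← hp.eVariationOn_comp]
  simp only [hf.edge]

theorem edist_le_edgeLength {f : C(X.Realization, M)} {γ : X.E → Γ} {x : X.V → HypSpace}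
    {F : X.E → C(I, HypSpace)} (hf : IsLift Γ p f γ x F) (e : X.E) :
    edist (x (X.src e)) ((γ e).1 (x (X.tgt e))) ≤ edgeLength f e := by
  rw [hp.edgeLength_eq hf, ← hf.src, ← hf.tgt]
  exact eVariationOn.edist_le _ (mem_univ _) (mem_univ _)

theorem ofReal_markedLength_le {f : C(X.Realization, M)} {γ : X.E → Γ} {x : X.V → HypSpace}
    {F : X.E → C(I, HypSpace)} (hf : IsLift Γ p f γ x F) :
    ENNReal.ofReal (markedLength γ x) ≤ graphLength f := by
  rw [ofReal_markedLength]
  exact Finset.sum_le_sum fun e _ => hp.edist_le_edgeLength hf e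

/-- There is a graph with geodesic edges with given vertices and edge labels. -/
theorem exists_geodesic_graph (γ : X.E → Γ) (x : X.V → HypSpace) :
    ∃ f : C(X.Realization, M), (∃ F, IsLift Γ p f γ x F) ∧
      ∀ e, edgeLength f e ≤ edist (x (X.src e)) ((γ e).1 (x (X.tgt e))) := by
  let F : X.E → C(I, HypSpace) := fun e => geodPath (x (X.src e)) ((γ e).1 (x (X.tgt e)))
  let f : C(X.Realization, M) := FiniteGraph.lift (fun v => p (x v))
    (fun e => (⟨p, hp.continuous⟩ : C(HypSpace, M)).comp (F e)) (fun e => by simp [F])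
    (fun e => by simp [F, hp.map_eq])
  have hf : IsLift Γ p f γ x F := ⟨fun v => rfl, fun e t => rfl, fun e => by simp [F],
    fun e => by simp [F]⟩
  refine ⟨f, ⟨F, hf⟩, fun e => ?_⟩
  rw [hp.edgeLength_eq hf]
  exact eVariationOn_geodPath_le _ _

/-- A minimal carrier graph is no longer than any graph with geodesic edges that is equivalent
to it. -/
theorem graphLength_le_markedLength {f : C(X.Realization, M)} (hf : IsCarrierGraph f)
    (hmin : IsMinimalInClass f) (η : ContinuousMap.HomotopyEquiv X.Realization Y.Realization)
    {γ : Y.E → Γ} {x : Y.V → HypSpace} {F : Y.E → C(I, HypSpace)}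
    (h : IsLift Γ p (f.comp η.invFun) γ x F) (z : Y.V → HypSpace) :
    graphLength f ≤ ENNReal.ofReal (markedLength γ z) := by
  obtain ⟨g, ⟨G, hg⟩, hle⟩ := hp.exists_geodesic_graph γ z
  have hfg : f.Homotopic (g.comp η.toFun) := by
    refine ContinuousMap.Homotopic.trans ?_ ((hp.homotopic_of_isLift h hg).comp
      (ContinuousMap.Homotopic.refl η.toFun))
    rw [ContinuousMap.comp_assoc]
    have := (ContinuousMap.Homotopic.refl f).comp η.left_inv.symm
    rwa [ContinuousMap.comp_id] at this
  have hgc : IsCarrierGraph g := hf.of_homotopyEquiv η hfg fun e =>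
    ((hle e).trans_lt (edist_lt_top _ _)).ne
  refine (hmin Y g hgc ⟨η, hfg⟩).trans ?_
  rw [ofReal_markedLength]
  exact Finset.sum_le_sum fun e _ => hle e

/-- Moving the vertices of a minimal carrier graph does not decrease its length. -/
theorem graphLength_le {f : C(X.Realization, M)} (hf : IsCarrierGraph f)
    (hmin : IsMinimalInClass f) {γ : X.E → Γ} {x : X.V → HypSpace} {F : X.E → C(I, HypSpace)}
    (h : IsLift Γ p f γ x F) (z : X.V → HypSpace) :
    graphLength f ≤ ENNReal.ofReal (markedLength γ z) :=
  hp.graphLength_le_markedLength hf hmin (ContinuousMap.HomotopyEquiv.refl _) (F := F) (x := x)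
    h z

/-- Splitting a vertex of a minimal carrier graph does not decrease its length. -/
theorem graphLength_le_split {f : C(X.Realization, M)} (hf : IsCarrierGraph f)
    (hmin : IsMinimalInClass f) {γ : X.E → Γ} {x : X.V → HypSpace} {F : X.E → C(I, HypSpace)}
    (h : IsLift Γ p f γ x F) {v : X.V} {A B : Set X.E} (hA : ∀ e ∈ A, X.src e = v)
    (hB : ∀ e ∈ B, X.tgt e = v) (z : Option X.V → HypSpace) :
    graphLength f ≤ ENNReal.ofReal (markedLength (X := X.split v A B)
      (fun o : Option X.E => o.elim 1 γ) z) := by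
  refine hp.graphLength_le_markedLength hf hmin (FiniteGraph.splitEquiv v A B hA hB)
    (x := fun o : Option X.V => x (o.getD v))
    (F := fun o : Option X.E => o.elim (.const I (x v)) F) ?_ z
  refine ⟨fun w => h.vertex _, ?_, ?_, ?_⟩
  · rintro (_ | e) t
    · exact h.vertex v
    · exact h.edge e t
  · rintro (_ | e)
    · rfl
    · by_cases he : e ∈ A
      · simp [FiniteGraph.split, he, h.src, hA e he]
      · simp [FiniteGraph.split, he, h.src]
  · rintro (_ | e)
    · rfl
    · by_cases he : e ∈ B
      · simp [FiniteGraph.split, he, h.tgt, hB e he]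
      · simp [FiniteGraph.split, he, h.tgt]

end IsUniformization
end

noncomputable section

open HypSpace

/-! ### Paths of minimal length -/

/-- A path whose length is the distance between its endpoints and that never pauses is a
reparametrization of a geodesic. -/
theorem HypSpace.exists_eq_geodPath {c : C(I, HypSpace)} {a b : HypSpace} (h0 : c 0 = a)
    (h1 : c 1 = b) (hlen : eVariationOn c univ = edist a b)
    (hc : ∀ s t : I, s < t → ∃ u ∈ Icc s t, c u ≠ c s) :
    ∃ ψ : I ≃o I, ∀ t, c t = geodPath a b (ψ t) := by
  have hlen' : ∀ s t : I, s ≤ t → dist a (c s) + dist (c s) (c t) + dist (c t) b ≤ dist a b := by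
    intro s t hst
    have hu : (univ : Set I) = univ ∩ Icc 0 1 := by ext t; simp [unitInterval.le_one']
    have h2 : edist a (c s) + edist (c s) (c t) + edist (c t) b ≤ edist a b := by
      rw [← hlen, hu, ← eVariationOn.Icc_add_Icc c t.2.1 t.2.2 (mem_univ t),
        ← eVariationOn.Icc_add_Icc c s.2.1 hst (mem_univ s), ← h0, ← h1]
      gcongr <;> apply eVariationOn.edist_le <;> simp [hst, unitInterval.le_one']
    simp only [edist_dist] at h2
    rwa [← ENNReal.ofReal_add dist_nonneg dist_nonneg, ← ENNReal.ofReal_add (by positivity)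
      dist_nonneg, ENNReal.ofReal_le_ofReal_iff dist_nonneg] at h2
  have hstep : ∀ s t : I, s ≤ t → dist a (c s) + dist (c s) (c t) ≤ dist a (c t) := by
    intro s t hst
    linarith [hlen' s t hst, dist_triangle a (c t) b]
  have hmono : StrictMono fun t => dist a (c t) := by
    intro s t hst
    obtain ⟨u, hu, hne⟩ := hc s t hst
    have := hstep s u hu.1
    have := hstep u t hu.2
    have : 0 < dist (c s) (c u) := dist_pos.2 hne.symm
    have : 0 ≤ dist (c u) (c t) := dist_nonneg
    change dist a (c s) < dist a (c t)
    linarith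
  have hD : 0 < dist a b := by
    have := hmono (show (0 : I) < 1 from zero_lt_one)
    simpa [h0, h1] using this
  have hle : ∀ t, dist a (c t) ≤ dist a b := fun t => by
    have := hmono.monotone (unitInterval.le_one' (t := t))
    simpa [h1] using this
  let ψ : I → I := fun t =>
    ⟨dist a (c t) / dist a b, by positivity, div_le_one_of_le₀ (hle t) dist_nonneg⟩
  have hψm : StrictMono ψ := fun s t hst => Subtype.mk_lt_mk.2
    (div_lt_div_of_pos_right (hmono hst) hD)
  have hψc : Continuous ψ := by
    refine Continuous.subtype_mk ?_ _
    exact (continuous_const.dist c.continuous).div_const _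
  have hψs : Function.Surjective ψ := fun u => by
    refine mem_range_of_exists_le_of_exists_ge hψc ⟨0, ?_⟩ ⟨1, ?_⟩
    · have : ψ 0 = 0 := Subtype.ext (by simp [ψ, h0])
      rw [this]; exact u.2.1
    · have : ψ 1 = 1 := Subtype.ext (by simp [ψ, h1, hD.ne'])
      rw [this]; exact u.2.2
  refine ⟨hψm.orderIsoOfSurjective ψ hψs, fun t => ?_⟩
  have hq : dist a (c t) + dist (c t) b = dist a b := by
    have := hlen' t t le_rfl
    rw [dist_self, add_zero] at this
    exact le_antisymm this (dist_triangle _ _ _)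
  change c t = geod a b (dist a (c t) / dist a b * dist a b)
  rw [div_mul_cancel₀ _ hD.ne']
  exact eq_geod hq

/-! ### Reparametrizing edges -/

namespace FiniteGraph

variable {X : FiniteGraph}

/-- The self-map of a graph that reparametrizes each edge. -/
def reparamMap (φ : X.E → I ≃o I) : C(X.Realization, X.Realization) :=
  lift X.vertex (fun e => ⟨fun t => X.edgePoint e (φ e t),
      (continuous_edgePoint e).comp (φ e).continuous⟩)
    (fun e => by
      have : φ e 0 = 0 := (φ e).map_bot
      simp [this, edgePoint_zero])
    (fun e => by
      have : φ e 1 = 1 := (φ e).map_top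
      simp [this, edgePoint_one])

/-- The self-homeomorphism of a graph that reparametrizes each edge. -/
def reparam (φ : X.E → I ≃o I) : X.Realization ≃ₜ X.Realization where
  toFun := reparamMap φ
  invFun := reparamMap fun e => (φ e).symm
  left_inv := realization_ind (fun v => rfl) fun e t => by simp [reparamMap]
  right_inv := realization_ind (fun v => rfl) fun e t => by simp [reparamMap]
  continuous_toFun := (reparamMap φ).continuous
  continuous_invFun := (reparamMap _).continuous

end FiniteGraph

/-! ### Minimal carrier graphs -/

variable {M : Type*} [MetricSpace M] {X : FiniteGraph}
  {Γ : Subgroup (HypSpace ≃ᵢ HypSpace)} {p : HypSpace → M} {f : C(X.Realization, M)}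
  {γ : X.E → Γ} {x : X.V → HypSpace} {F : X.E → C(I, HypSpace)}

theorem markedLength_nonneg (γ : X.E → Γ) (x : X.V → HypSpace) : 0 ≤ markedLength γ x :=
  Finset.sum_nonneg fun _ _ => dist_nonneg

theorem IsLift.endpoints_ne (hl : IsLift Γ p f γ x F)
    (hlen : ∀ e, eVariationOn (F e) univ = edist (x (X.src e)) ((γ e).1 (x (X.tgt e))))
    (hf : NeverPauses f) (e : X.E) : x (X.src e) ≠ (γ e).1 (x (X.tgt e)) := by
  intro h
  have h0 := hlen e
  rw [h, edist_self, eVariationOn.eq_zero_iff] at h0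
  obtain ⟨t, -, ht⟩ := hf e 0 1 zero_lt_one
  rw [← hl.edge, ← hl.edge, edist_eq_zero.1 (h0 t (mem_univ _) 0 (mem_univ _))] at ht
  exact ht rfl

namespace IsUniformization

variable (hp : IsUniformization Γ p)
include hp

theorem graphLength_eq (hf : IsCarrierGraph f) (hmin : IsMinimalInClass f)
    (hl : IsLift Γ p f γ x F) : graphLength f = ENNReal.ofReal (markedLength γ x) :=
  le_antisymm (hp.graphLength_le hf hmin hl x) (hp.ofReal_markedLength_le hl)

theorem markedLength_le (hf : IsCarrierGraph f) (hmin : IsMinimalInClass f)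
    (hl : IsLift Γ p f γ x F) (z : X.V → HypSpace) : markedLength γ x ≤ markedLength γ z := by
  rw [← ENNReal.ofReal_le_ofReal_iff (markedLength_nonneg γ z), ← hp.graphLength_eq hf hmin hl]
  exact hp.graphLength_le hf hmin hl z

/-- The lifts of the edges of a minimal carrier graph have minimal length. -/
theorem eVariationOn_eq (hf : IsCarrierGraph f) (hmin : IsMinimalInClass f)
    (hl : IsLift Γ p f γ x F) (e : X.E) :
    eVariationOn (F e) univ = edist (x (X.src e)) ((γ e).1 (x (X.tgt e))) := by
  classical
  rw [← hp.edgeLength_eq hl]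
  refine le_antisymm ?_ (hp.edist_le_edgeLength hl e)
  have h := hp.graphLength_eq hf hmin hl
  rw [ofReal_markedLength, graphLength, ← Finset.add_sum_erase _ _ (Finset.mem_univ e),
    ← Finset.add_sum_erase _ _ (Finset.mem_univ e)] at h
  have hfin : ∑ e ∈ Finset.univ.erase e, edgeLength f e ≠ ⊤ :=
    ENNReal.sum_ne_top.2 fun e _ => hf.rectifiable e
  refine (ENNReal.add_le_add_iff_right hfin).1 (h.le.trans ?_)
  gcongr with e'
  exact hp.edist_le_edgeLength hl e'

open Classical in
/-- No two ends of edges of a minimal carrier graph at a vertex have the same direction. -/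
theorem card_ends_lt_two (hf : IsCarrierGraph f) (hmin : IsMinimalInClass f)
    (hl : IsLift Γ p f γ x F) (hne : ∀ e, x (X.src e) ≠ (γ e).1 (x (X.tgt e))) (v : X.V)
    (w : ℝ → HypSpace) (A B : Set X.E)
    (hA : ∀ e ∈ A, X.src e = v ∧ ∀ ε ∈ Icc 0 (dist (x (X.src e)) ((γ e).1 (x (X.tgt e)))),
      geod (x (X.src e)) ((γ e).1 (x (X.tgt e))) ε = w ε)
    (hB : ∀ e ∈ B, X.tgt e = v ∧ ∀ ε ∈ Icc 0 (dist (x (X.src e)) ((γ e).1 (x (X.tgt e)))),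
      geod (x (X.tgt e)) ((γ e).1.symm (x (X.src e))) ε = w ε) :
    (Finset.univ.filter (· ∈ A)).card + (Finset.univ.filter (· ∈ B)).card < 2 := by
  by_contra! hcard
  set d : X.E → ℝ := fun e => dist (x (X.src e)) ((γ e).1 (x (X.tgt e))) with hd
  obtain ⟨ε, hε, hεd⟩ : ∃ ε > 0, ∀ e, 2 * ε ≤ d e := by
    have h : ∀ᶠ ε : ℝ in 𝓝[>] 0, ∀ e, 2 * ε ≤ d e := by
      refine Filter.eventually_all.2 fun e => nhdsWithin_le_nhds ?_
      have hc : Filter.Tendsto (fun ε : ℝ => 2 * ε) (𝓝 0) (𝓝 (2 * 0)) :=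
        (continuous_const.mul continuous_id).tendsto 0
      rw [mul_zero] at hc
      exact (hc.eventually_lt_const (dist_pos.2 (hne e))).mono fun _ h => h.le
    obtain ⟨ε, h1, h2⟩ := (h.and self_mem_nhdsWithin).exists
    exact ⟨ε, h2, h1⟩
  have hmem : ∀ e, ε ∈ Icc 0 (d e) := fun e => ⟨hε.le, by linarith [hεd e]⟩
  have hBγ : ∀ e ∈ B, (γ e).1 (w ε) =
      geod (x (X.src e)) ((γ e).1 (x (X.tgt e))) (d e - ε) := fun e he => by
    have h1 : dist (x (X.tgt e)) ((γ e).1.symm (x (X.src e))) = d e := by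
      rw [← (γ e).1.dist_eq, IsometryEquiv.apply_symm_apply, dist_comm]
    rw [← (hB e he).2 ε (hmem e), map_geod _ (by rw [h1]; exact hmem e),
      IsometryEquiv.apply_symm_apply, geod_comm (hmem e)]
  have hwv : dist (x v) (w ε) ≤ ε := by
    have : (Finset.univ.filter (· ∈ A)).Nonempty ∨ (Finset.univ.filter (· ∈ B)).Nonempty := by
      by_contra! h
      rw [h.1, h.2] at hcard
      simp at hcard
    rcases this with ⟨e, he⟩ | ⟨e, he⟩ <;> rw [Finset.mem_filter] at he
    · rw [← (hA e he.2).2 ε (hmem e), ← (hA e he.2).1, dist_left_geod (hmem e)]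
    · rw [← (hB e he.2).1, ← (γ e).1.dist_eq, hBγ e he.2, dist_comm,
        dist_geod_right ⟨by linarith [hεd e], by linarith⟩]
      exact le_of_eq (by simp [hd])
  have h := hp.graphLength_le_split hf hmin hl (fun e he => (hA e he).1)
    (fun e he => (hB e he).1) (fun o => o.elim (w ε) x)
  rw [hp.graphLength_eq hf hmin hl] at h
  replace h := (ENNReal.ofReal_le_ofReal_iff (markedLength_nonneg (X := X.split v A B) _ _)).1 h
  have hterm : ∀ e, dist (if e ∈ A then w ε else x (X.src e))
      ((γ e).1 (if e ∈ B then w ε else x (X.tgt e))) =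
      d e - ((if e ∈ A then ε else 0) + if e ∈ B then ε else 0) := fun e => by
    have hside : d e - ε ∈ Icc 0 (d e) := ⟨by linarith [hεd e], by linarith⟩
    by_cases hAe : e ∈ A <;> by_cases hBe : e ∈ B <;> simp only [hAe, hBe, if_true, if_false]
    · rw [hBγ e hBe, ← (hA e hAe).2 ε (hmem e), dist_geod (hne e), abs_of_nonpos
        (by linarith [hεd e])]
      ring
    · rw [← (hA e hAe).2 ε (hmem e), dist_geod_right (hmem e), add_zero]
    · rw [hBγ e hBe, dist_left_geod hside, zero_add]
    · simp [hd]
  have hsum : markedLength (X := X.split v A B) (fun o : Option X.E => o.elim 1 γ)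
      (fun o : Option X.V => o.elim (w ε) x) = dist (x v) (w ε) +
        ∑ e, dist (if e ∈ A then w ε else x (X.src e))
          ((γ e).1 (if e ∈ B then w ε else x (X.tgt e))) := by
    refine (Fintype.sum_option _).trans (congrArg₂ _ rfl (Finset.sum_congr rfl fun e _ => ?_))
    by_cases hAe : e ∈ A <;> by_cases hBe : e ∈ B <;> simp [FiniteGraph.split, hAe, hBe]
  rw [hsum, Finset.sum_congr rfl fun e _ => hterm e, Finset.sum_sub_distrib,
    Finset.sum_add_distrib, ← Finset.sum_filter, ← Finset.sum_filter, Finset.sum_const,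
    Finset.sum_const, nsmul_eq_mul, nsmul_eq_mul, markedLength] at h
  have hc : (2 : ℝ) ≤ (Finset.univ.filter (· ∈ A)).card + (Finset.univ.filter (· ∈ B)).card := by
    exact_mod_cast hcard
  nlinarith

/-- The lifts of the vertices of freely homotopic minimal carrier graphs coincide. -/
theorem lift_vertex_eq (hX : ∀ v, 3 ≤ X.valence v) (hf : IsCarrierGraph f)
    (hmin : IsMinimalInClass f) (hf' : NeverPauses f) (hl : IsLift Γ p f γ x F)
    {g : C(X.Realization, M)} (hg : IsCarrierGraph g) (hming : IsMinimalInClass g)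
    {y : X.V → HypSpace} {G : X.E → C(I, HypSpace)} (hlg : IsLift Γ p g γ y G) : x = y := by
  classical
  have hne := hl.endpoints_ne (hp.eVariationOn_eq hf hmin hl) hf'
  have hconv : ∀ e ∈ Finset.univ, dist (mid (x (X.src e)) (y (X.src e)))
      ((γ e).1 (mid (x (X.tgt e)) (y (X.tgt e)))) ≤
      (dist (x (X.src e)) ((γ e).1 (x (X.tgt e))) +
        dist (y (X.src e)) ((γ e).1 (y (X.tgt e)))) / 2 := fun e _ => by
    rw [map_mid]; exact dist_mid_mid_le _ _ _ _
  have hxy := hp.markedLength_le hf hmin hl y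
  have hyx := hp.markedLength_le hg hming hlg x
  have hxm := hp.markedLength_le hf hmin hl fun v => mid (x v) (y v)
  have heq := (Finset.sum_eq_sum_iff_of_le hconv).1 (le_antisymm (Finset.sum_le_sum hconv) (by
    rw [← Finset.sum_div, Finset.sum_add_distrib]
    simp only [markedLength] at hxy hyx hxm
    linarith))
  have hgram : ∀ e, gram (x (X.src e)) (y (X.src e)) ((γ e).1 (x (X.tgt e))) = 0 ∧
      gram (x (X.tgt e)) (y (X.tgt e)) ((γ e).1.symm (x (X.src e))) = 0 := fun e => by
    have h := heq e (Finset.mem_univ e)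
    rw [map_mid] at h
    obtain ⟨h1, h2⟩ := gram_eq_zero_of_dist_mid_mid h
    refine ⟨h1, ?_⟩
    rwa [← gram_map (γ e).1, IsometryEquiv.apply_symm_apply]
  funext v
  by_contra hv
  let S (r : ℝ) : Set X.E := {e | X.src e = v ∧
    ∀ ε ∈ Icc 0 (dist (x (X.src e)) ((γ e).1 (x (X.tgt e)))),
      geod (x (X.src e)) ((γ e).1 (x (X.tgt e))) ε = geod (x v) (y v) (r * ε)}
  let T (r : ℝ) : Set X.E := {e | X.tgt e = v ∧
    ∀ ε ∈ Icc 0 (dist (x (X.src e)) ((γ e).1 (x (X.tgt e)))),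
      geod (x (X.tgt e)) ((γ e).1.symm (x (X.src e))) ε = geod (x v) (y v) (r * ε)}
  have hlt : ∀ r : ℝ, (Finset.univ.filter (· ∈ S r)).card +
      (Finset.univ.filter (· ∈ T r)).card < 2 := fun r => by
    convert! hp.card_ends_lt_two hf hmin hl hne v (fun ε => geod (x v) (y v) (r * ε)) (S r) (T r)
      (fun e he => he) (fun e he => he)
  have hS : (Finset.univ.filter fun e => X.src e = v).card ≤
      (Finset.univ.filter (· ∈ S 1)).card + (Finset.univ.filter (· ∈ S (-1))).card := by
    refine (Finset.card_le_card fun e he => ?_).trans (Finset.card_union_le _ _)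
    obtain rfl := (Finset.mem_filter.1 he).2
    rw [Finset.mem_union, Finset.mem_filter, Finset.mem_filter]
    rcases exists_sign_geod_eq hv (hne e) (hgram e).1 with h | h
    · exact .inl ⟨Finset.mem_univ _, rfl, fun ε hε => by rw [one_mul, h ε hε]⟩
    · exact .inr ⟨Finset.mem_univ _, rfl, fun ε hε => by rw [neg_one_mul, h ε hε]⟩
  have hT : (Finset.univ.filter fun e => X.tgt e = v).card ≤
      (Finset.univ.filter (· ∈ T 1)).card + (Finset.univ.filter (· ∈ T (-1))).card := by
    refine (Finset.card_le_card fun e he => ?_).trans (Finset.card_union_le _ _)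
    obtain rfl := (Finset.mem_filter.1 he).2
    rw [Finset.mem_union, Finset.mem_filter, Finset.mem_filter]
    have hd : dist (x (X.tgt e)) ((γ e).1.symm (x (X.src e))) =
        dist (x (X.src e)) ((γ e).1 (x (X.tgt e))) := by
      rw [← (γ e).1.dist_eq, IsometryEquiv.apply_symm_apply, dist_comm]
    have hne' : x (X.tgt e) ≠ (γ e).1.symm (x (X.src e)) := by
      rw [← dist_pos, hd]; exact dist_pos.2 (hne e)
    rcases exists_sign_geod_eq hv hne' (hgram e).2 with h | h
    · exact .inl ⟨Finset.mem_univ _, rfl, fun ε hε => by rw [one_mul, h ε (by rwa [hd])]⟩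
    · exact .inr ⟨Finset.mem_univ _, rfl, fun ε hε => by rw [neg_one_mul, h ε (by rwa [hd])]⟩
  have h3 := hX v
  rw [FiniteGraph.valence] at h3
  have := hlt 1
  have := hlt (-1)
  omega

/-- The lift of an edge of a minimal carrier graph is a reparametrized geodesic. -/
theorem exists_edge_eq_geodPath (hf : IsCarrierGraph f) (hmin : IsMinimalInClass f)
    (hf' : NeverPauses f) (hl : IsLift Γ p f γ x F) (e : X.E) :
    ∃ ψ : I ≃o I, ∀ t, F e t = geodPath (x (X.src e)) ((γ e).1 (x (X.tgt e))) (ψ t) := by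
  refine exists_eq_geodPath (hl.src e) (hl.tgt e) (hp.eVariationOn_eq hf hmin hl e)
    fun s t hst => ?_
  obtain ⟨u, hu, hne⟩ := hf' e s t hst
  refine ⟨u, hu, fun h => hne ?_⟩
  rw [← hl.edge, ← hl.edge, h]

theorem essentiallyEquivalent (hX : ∀ v, 3 ≤ X.valence v) {g : C(X.Realization, M)}
    (hf : IsCarrierGraph f) (hg : IsCarrierGraph g) (hf' : NeverPauses f) (hg' : NeverPauses g)
    (hmin : IsMinimalInClass f) (hming : IsMinimalInClass g) (hfg : f.Homotopic g) :
    EssentiallyEquivalent f g := by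
  obtain ⟨γ, x, F, hl⟩ := hp.exists_isLift f
  obtain ⟨y, G, hlg⟩ := hp.exists_isLift_of_homotopic hfg hl
  obtain rfl := hp.lift_vertex_eq hX hf hmin hf' hl hg hming hlg
  choose φ hφ using hp.exists_edge_eq_geodPath hf hmin hf' hl
  choose ψ hψ using hp.exists_edge_eq_geodPath hg hming hg' hlg
  refine ⟨FiniteGraph.reparam fun e => (φ e).trans (ψ e).symm, fun v => rfl,
    fun e => ⟨(φ e).trans (ψ e).symm, fun t => rfl⟩, FiniteGraph.realization_ind (fun v => ?_) fun e t => ?_⟩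
  · exact (hl.vertex v).symm.trans (hlg.vertex v)
  · change f (X.edgePoint e t) = g (X.edgePoint e ((ψ e).symm (φ e t)))
    rw [← hl.edge, ← hlg.edge, hφ, hψ, OrderIso.apply_symm_apply]

end IsUniformization

theorem IsMinimalGlobally.isMinimalInClass (h : IsMinimalGlobally f) : IsMinimalInClass f :=
  fun Y g hg _ => h Y g hg

end

theorem theorem1 {M : Type*} [MetricSpace M] (hM : IsHyperbolicThreeManifold M)
    (X : FiniteGraph) (hX : ∀ v : X.V, 3 ≤ X.valence v)
    (f g : C(X.Realization, M)) (hf : IsCarrierGraph f) (hg : IsCarrierGraph g)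
    (hf' : NeverPauses f) (hg' : NeverPauses g)
    (hmin : (IsMinimalInClass f ∧ IsMinimalInClass g) ∨
      (IsMinimalGlobally f ∧ IsMinimalGlobally g))
    (hfg : ContinuousMap.Homotopic f g) :
    EssentiallyEquivalent f g := by
  obtain ⟨Γ, p, h1, h2, h3, h4, h5⟩ := hM
  have hp : IsUniformization Γ p := ⟨h1, h2, h3, h4, h5⟩
  rcases hmin with ⟨hmf, hmg⟩ | ⟨hmf, hmg⟩
  · exact hp.essentiallyEquivalent hX hf hg hf' hg' hmf hmg hfg
  · exact hp.essentiallyEquivalent hX hf hg hf' hg' hmf.isMinimalInClass hmg.isMinimalInClass hfg
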